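/- For positive integers $k\ge 3$ and $s\ge 0$ define $g_k(s)=0$ for $s<k$, and for $s\ge k$ let $g_k(s)$ be the maximum of $\sum_{i=1}^k g_k(s_i)+\prod_{i=1}^k s_i$ over all $(s_1,\dots,s_k)$ with $s_1+\cdots+s_k=s$ and $0\le s_i<s$. Let $r_k(s,t;n)$ be the minimum $N$ such that every red/blue coloring of the edges of the complete $k$-uniform hypergraph on $N$ vertices contains a set of $n$ vertices all of whose edges are blue, or a set of $s$ vertices which contains at least $t$ red edges ($r_k(s,t;n)=\infty$ if no such $N$ exists). Let $h_1^{(k)}(s)$ denote the value $t_1\ge 1$ at which $r_k(s,t_1-1;n)$ is polynomial in $n$ (at most $n^{C}$ for some constant $C$ and all large $n$) while $r_k(s,t_1;n)$ is at least exponential in a power of $n$ (at least $2^{n^{c}}$ for some constant $c>0$ and all large $n$). Then for every $k\ge 4$ and every $s=k^m$ with $m\ge 1$, the value $h_1^{(k)}(s)$ exists, is unique, and $$h_1^{(k)}(s)=g_k(s)+1 .$$ -/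

import Mathlib

open Filter

/-- `ErdosHajnal.g k s` is the function `g_k(s)`: it is `0` for `s < k`, and for `s ≥ k` it is the
maximum of `∑ g_k(s_i) + ∏ s_i` over all partitions `s_1 + ⋯ + s_k = s` with `0 ≤ s_i < s`. -/
def ErdosHajnal.g (k s : ℕ) : ℕ :=
  if s < k then 0
  else
    (Finset.univ.filter fun p : Fin k → Fin s => ∑ i, (p i : ℕ) = s).sup fun p =>
      ∑ i, ErdosHajnal.g k (p i) + ∏ i, (p i : ℕ)
termination_by s
decreasing_by exact (p i).isLt

/-- Every red/blue coloring of the edges (the `k`-element subsets of the vertex set `Fin N`) of the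
complete `k`-uniform hypergraph on `N` vertices contains a set of `n` vertices all of whose edges
are blue, or a set of `s` vertices which contains at least `t` red edges.
Here `red e = true` means that `e` is red; only values of `red` at `k`-element sets matter. -/
def ErdosHajnal.Arrows (k s t n N : ℕ) : Prop :=
  ∀ red : Finset (Fin N) → Bool,
    (∃ A : Finset (Fin N), A.card = n ∧ ∀ e ∈ A.powersetCard k, red e = false) ∨
    (∃ S : Finset (Fin N), S.card = s ∧
      t ≤ ((S.powersetCard k).filter fun e => red e = true).card)

/-- The generalized Ramsey number `r_k(s, t; n)`: the least `N` with `Arrows k s t n N`, and `⊤` if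
there is no such `N`. -/
noncomputable def ErdosHajnal.r (k s t n : ℕ) : ℕ∞ :=
  ⨅ (N : ℕ) (_ : ErdosHajnal.Arrows k s t n N), (N : ℕ∞)

/-- `f n` is polynomial in `n`: it is at most a fixed power of `n` for all large `n`. -/
def ErdosHajnal.IsPolynomial (f : ℕ → ℕ∞) : Prop :=
  ∃ C : ℕ, ∀ᶠ n : ℕ in atTop, f n ≤ ((n ^ C : ℕ) : ℕ∞)

/-- `f n` is at least exponential in a power of `n`: for some `c > 0`, it is at least `2 ^ (n ^ c)`
for all large `n`. -/
def ErdosHajnal.IsExponentialInPower (f : ℕ → ℕ∞) : Prop :=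
  ∃ c : ℝ, 0 < c ∧ ∀ᶠ n : ℕ in atTop,
    ENNReal.ofReal ((2 : ℝ) ^ ((n : ℝ) ^ c)) ≤ ((f n : ℕ∞) : ENNReal)

/-- `h` is a value of `h_1^{(k)}(s)`, the `t` at which the growth of `r_k(s, t; n)` as a function of
`n` changes from polynomial to exponential in a power of `n`. -/
structure ErdosHajnal.IsH1 (k s h : ℕ) : Prop where
  one_le : 1 ≤ h
  polynomial : ErdosHajnal.IsPolynomial (ErdosHajnal.r k s (h - 1))
  exponential : ErdosHajnal.IsExponentialInPower (ErdosHajnal.r k s h)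

/-!
Let `e = g k (k ^ m)`. The proof shows that `r k (k ^ m) e` is polynomial and that
`r k (k ^ m) (e + 1)` is exponential in a power of `n`; since `r` is monotone in the number of red
edges and no function is both, the transition happens at `e + 1` and nowhere else.

The inequality `(k ^ k - k) ∏ w i + ∑ w i ^ k ≤ (∑ w i) ^ k` (`mul_prod_add_sum_pow_le`) gives
`g k s ≤ (s ^ k - s) / (k ^ k - k)`, with equality for powers of `k`, where the balanced partitions
are optimal (`g_pow_mul`). So `e` is the number of edges of the `m`-fold iterated balanced complete
`k`-partite hypergraph on `k ^ m` vertices.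

*Polynomial side.* If every `n`-set contains a red edge, the red edges have density at least a
negative power of `n`. By supersaturation, applied to one coordinate at a time, such a relation
contains a product `A 1 × ⋯ × A k` of members of any family with a member inside every polynomially
large set (`exists_product_subset`). Induction on `m` then finds the iterated hypergraph in red
(`exists_card_pow_red`).

*Exponential side.* Label each ordered pair `u < v` of vertices at random by a pair `(i, j)`,
meaning that `u` may play the part `i` and `v` the part `j`, and color a `k`-set red if its vertices
can play the parts `1, …, k` consistently with all labels. Every `n`-set contains about `n ^ 2`
increasing `k`-tuples sharing no pair, so a union bound leaves no blue `n`-set as long as the number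
of vertices is at most `2 ^ √n` (`exists_map_hitting`).

It remains to bound the number of consistent tuples for an arbitrary labeling of `s` vertices by
`(s ^ k - s) / (k ^ k - k)`. This is proved in a weighted form (`copies_add_le`): for weights
`x ≥ 0`, with `c = 1 / (k ^ k - k)` and `copies x` the weight of the consistent tuples,
`copies x + c ∑ x v ^ k ≤ c (∑ x v) ^ k`. In a counterexample of minimal support, take the maximum
over the simplex. The first order condition (`exists_extremal`) makes all degrees so large that
every vertex has a dominant part `r v`, which it plays towards all but a proportion `21 / (20 k)`
of the vertices (`exists_dominant`). Consider the partition of the vertices by `r`, and call a pair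
between two classes bad if its label is not the one prescribed by `r`. A consistent tuple is
transversal, inside one class, or mixed. Mixed tuples contain at least `k - 2` bad pairs, and a bad
pair lies in few consistent tuples because one of its ends plays a part that is not dominant
(`mixedCopies_le`). On the other hand each bad pair blocks many transversals. Hence the mixed tuples
are outweighed by the missing transversals (`mixedCopies_le_of_five_le`, `mixedCopies_le_of_four`),
and the tuples inside the classes are controlled by the minimality of the counterexample, so that
the inequality for `∏ w i` and `∑ w i ^ k` gives a contradiction (`false_of_mixedCopies_le`).
-/

namespace ErdosHajnal

/-! ### AM-GM and the closed form of `g` -/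

theorem prod_le_mean_pow {ι : Type*} (s : Finset ι) (z : ι → ℝ) (hz : ∀ i ∈ s, 0 ≤ z i) :
    ∏ i ∈ s, z i ≤ ((∑ i ∈ s, z i) / s.card) ^ s.card := by
  rcases s.eq_empty_or_nonempty with rfl | hs
  · simp
  have hn : s.card ≠ 0 := Finset.card_ne_zero.mpr hs
  have hn' : (s.card : ℝ) ≠ 0 := by exact_mod_cast hn
  have h := Real.geom_mean_le_arith_mean_weighted s (fun _ => (s.card : ℝ)⁻¹) z
    (fun _ _ => by positivity) (by simp [hn']) hz
  have h2 := pow_le_pow_left₀ (Finset.prod_nonneg fun i hi => Real.rpow_nonneg (hz i hi) _) h s.card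
  rw [← Finset.prod_pow, ← Finset.mul_sum] at h2
  calc ∏ i ∈ s, z i = ∏ i ∈ s, (z i ^ (s.card : ℝ)⁻¹) ^ s.card :=
        Finset.prod_congr rfl fun i hi => (Real.rpow_inv_natCast_pow (hz i hi) hn).symm
    _ ≤ _ := h2
    _ = _ := by rw [inv_mul_eq_div]

/-- Averaging the monomials over the cyclic shifts of the index set. -/
theorem mul_prod_le_sum_shift {k : ℕ} [NeZero k] (w : Fin k → ℝ) (hw : ∀ i, 0 ≤ w i)
    (f : Fin k → Fin k) :
    k * ∏ i, w i ≤ ∑ c : Fin k, ∏ i, w (f i + c) := by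
  have hk : (0 : ℝ) < k := by exact_mod_cast Nat.pos_of_ne_zero (NeZero.ne k)
  have h := prod_le_mean_pow Finset.univ (fun c : Fin k => ∏ i, w (f i + c))
    (fun c _ => Finset.prod_nonneg fun i _ => hw _)
  have h1 : ∏ c : Fin k, ∏ i, w (f i + c) = (∏ i, w i) ^ k := by
    rw [Finset.prod_comm]
    have : ∀ i, ∏ c : Fin k, w (f i + c) = ∏ c, w c := fun i =>
      Fintype.prod_equiv (Equiv.addLeft (f i)) _ _ (fun c => rfl)
    simp [this]
  simp only [Finset.card_univ, Fintype.card_fin] at h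
  rw [h1] at h
  have h2 := le_of_pow_le_pow_left₀ (NeZero.ne k)
    (div_nonneg (Finset.sum_nonneg fun c _ => Finset.prod_nonneg fun i _ => hw _) hk.le) h
  rwa [le_div_iff₀ hk, mul_comm] at h2

/-- The inequality behind all the recursions: expand `(∑ w i) ^ k` into `k ^ k` monomials, set the
`k` pure powers aside and apply AM-GM to the others. -/
theorem mul_prod_add_sum_pow_le {k : ℕ} [NeZero k] (w : Fin k → ℝ) (hw : ∀ i, 0 ≤ w i) :
    ((k : ℝ) ^ k - k) * ∏ i, w i + ∑ i, w i ^ k ≤ (∑ i, w i) ^ k := by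
  classical
  have hk : (0 : ℝ) < k := by exact_mod_cast Nat.pos_of_ne_zero (NeZero.ne k)
  set C : Finset (Fin k → Fin k) := Finset.univ.image (fun c : Fin k => fun _ => c) with hC
  have hinj : Function.Injective (fun c : Fin k => (fun _ : Fin k => c)) := by
    intro a b hab
    exact congrFun hab 0
  have hexp : (∑ i, w i) ^ k = ∑ f : Fin k → Fin k, ∏ i, w (f i) := by
    rw [← Fin.prod_const, Finset.prod_univ_sum]
    simp
  have hsplit := Finset.sum_add_sum_compl C (fun f : Fin k → Fin k => ∏ i, w (f i))
  have hconst : ∑ f ∈ C, ∏ i, w (f i) = ∑ i, w i ^ k := by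
    rw [hC, Finset.sum_image (fun a _ b _ h => hinj h)]
    simp
  have hcard : (Cᶜ.card : ℝ) = (k : ℝ) ^ k - k := by
    have h1 : C.card = k := by
      rw [hC, Finset.card_image_of_injective _ hinj]; simp
    have h2 := Finset.card_add_card_compl C
    rw [h1] at h2
    simp only [Fintype.card_fun, Fintype.card_fin] at h2
    have h3 : (k : ℝ) + Cᶜ.card = (k : ℝ) ^ k := by exact_mod_cast h2
    linarith
  have hshift : ∀ c : Fin k, ∑ f ∈ Cᶜ, ∏ i, w (f i + c) = ∑ f ∈ Cᶜ, ∏ i, w (f i) := by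
    intro c
    refine Finset.sum_equiv (Equiv.addRight (fun _ : Fin k => c)) ?_ (fun f _ => rfl)
    intro f
    simp only [hC, Finset.mem_compl, Finset.mem_image, Finset.mem_univ, true_and, not_exists,
      Equiv.coe_addRight]
    constructor
    · rintro h d hd
      exact h (d - c) (by
        funext i
        have := congrFun hd i
        simp only [Pi.add_apply] at this
        simp [this])
    · rintro h d hd
      exact h (d + c) (by funext i; simp [← hd])
  have hmain : (k : ℝ) * (Cᶜ.card * ∏ i, w i) ≤ k * ∑ f ∈ Cᶜ, ∏ i, w (f i) := by
    calc (k : ℝ) * (Cᶜ.card * ∏ i, w i) = ∑ f ∈ Cᶜ, k * ∏ i, w i := by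
          rw [Finset.sum_const, nsmul_eq_mul]; ring
      _ ≤ ∑ f ∈ Cᶜ, ∑ c : Fin k, ∏ i, w (f i + c) :=
          Finset.sum_le_sum fun f _ => mul_prod_le_sum_shift w hw f
      _ = ∑ c : Fin k, ∑ f ∈ Cᶜ, ∏ i, w (f i + c) := Finset.sum_comm
      _ = k * ∑ f ∈ Cᶜ, ∏ i, w (f i) := by
          rw [Finset.sum_congr rfl fun c _ => hshift c]; simp
  have := le_of_mul_le_mul_left hmain hk
  rw [hcard] at this
  rw [hexp, ← hsplit, hconst]
  linarith

theorem natCast_lt_pow_self {k : ℕ} (hk : 2 ≤ k) : (k : ℝ) < (k : ℝ) ^ k := by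
  have : k ^ 1 < k ^ k := Nat.pow_lt_pow_right (by omega) (by omega)
  rw [pow_one] at this
  exact_mod_cast this

/-- The closed form upper bound for `g`, by induction along the recursion. -/
theorem g_mul_le {k : ℕ} (hk : 2 ≤ k) (s : ℕ) :
    (g k s : ℝ) * ((k : ℝ) ^ k - k) ≤ (s : ℝ) ^ k - s := by
  have : NeZero k := ⟨by omega⟩
  have hpos : 0 < (k : ℝ) ^ k - k := sub_pos.mpr (natCast_lt_pow_self hk)
  induction s using Nat.strong_induction_on with
  | _ s ih =>
    have hs0 : (0 : ℝ) ≤ (s : ℝ) ^ k - s := by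
      have : s ≤ s ^ k := Nat.le_self_pow (by omega) s
      have : (s : ℝ) ≤ (s : ℝ) ^ k := by exact_mod_cast this
      linarith
    rw [g]
    split_ifs with hlt
    · simpa using hs0
    rw [← le_div_iff₀ hpos]
    refine le_trans ?_ (Nat.floor_le (div_nonneg hs0 hpos.le))
    refine Nat.cast_le.mpr (Finset.sup_le fun p hp => Nat.le_floor ?_)
    rw [le_div_iff₀ hpos]
    simp only [Finset.mem_filter, Finset.mem_univ, true_and] at hp
    have h1 := mul_prod_add_sum_pow_le (fun i => ((p i : ℕ) : ℝ)) (fun i => Nat.cast_nonneg _)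
    have h2 : ∑ i, (((p i : ℕ) : ℝ)) = s := by exact_mod_cast hp
    have h3 : ∑ i, (g k (p i) : ℝ) * ((k : ℝ) ^ k - k) ≤ ∑ i, (((p i : ℕ) : ℝ) ^ k - (p i : ℕ)) :=
      Finset.sum_le_sum fun i _ => ih (p i) (p i).isLt
    rw [Finset.sum_sub_distrib, ← Finset.sum_mul, h2] at h3
    rw [h2] at h1
    push_cast
    linarith

/-- The balanced partition shows that `g k (k ^ m)` is at least the number of edges of the `m`-fold
iterated balanced complete `k`-partite hypergraph. -/
theorem le_g_pow_succ {k : ℕ} (hk : 2 ≤ k) (m : ℕ) :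
    k * g k (k ^ m) + (k ^ m) ^ k ≤ g k (k ^ (m + 1)) := by
  have hlt : k ^ m < k ^ (m + 1) := Nat.pow_lt_pow_right (by omega) (by omega)
  rw [g.eq_1 k (k ^ (m + 1))]
  have : ¬ k ^ (m + 1) < k := by
    rw [not_lt]; exact Nat.le_self_pow (by omega) k
  rw [if_neg this]
  have hp : (fun _ : Fin k => (⟨k ^ m, hlt⟩ : Fin (k ^ (m + 1)))) ∈
      (Finset.univ.filter fun p : Fin k → Fin (k ^ (m + 1)) =>
        ∑ i, (p i : ℕ) = k ^ (m + 1)) := by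
    simp [pow_succ, mul_comm]
  refine le_trans ?_ (Finset.le_sup hp)
  simp

theorem g_pow_mul {k : ℕ} (hk : 2 ≤ k) (m : ℕ) :
    (g k (k ^ m) : ℝ) * ((k : ℝ) ^ k - k) = ((k : ℝ) ^ m) ^ k - (k : ℝ) ^ m := by
  apply le_antisymm
  · exact_mod_cast g_mul_le hk (k ^ m)
  · have hpos : 0 < (k : ℝ) ^ k - k := sub_pos.mpr (natCast_lt_pow_self hk)
    induction m with
    | zero =>
      simp only [pow_zero, one_pow, sub_self]
      positivity
    | succ m ih =>
      have h := le_g_pow_succ hk m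
      have h' : (k : ℝ) * g k (k ^ m) + ((k : ℝ) ^ m) ^ k ≤ g k (k ^ (m + 1)) := by
        exact_mod_cast h
      have h2 := mul_le_mul_of_nonneg_right h' hpos.le
      refine le_trans ?_ h2
      have hk0 : (0 : ℝ) ≤ k := Nat.cast_nonneg k
      have h3 := mul_le_mul_of_nonneg_left ih hk0
      have h4 : ((k : ℝ) ^ (m + 1)) ^ k = ((k : ℝ) ^ m) ^ k * (k : ℝ) ^ k := by
        rw [pow_succ, mul_pow]
      rw [h4, pow_succ]
      linarith

theorem g_pow_succ {k : ℕ} (hk : 2 ≤ k) (m : ℕ) :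
    g k (k ^ (m + 1)) = k * g k (k ^ m) + (k ^ m) ^ k := by
  have hpos : 0 < (k : ℝ) ^ k - k := sub_pos.mpr (natCast_lt_pow_self hk)
  have h1 := g_pow_mul hk m
  have h2 := g_pow_mul hk (m + 1)
  have h4 : ((k : ℝ) ^ (m + 1)) ^ k = ((k : ℝ) ^ m) ^ k * (k : ℝ) ^ k := by
    rw [pow_succ, mul_pow]
  have h3 : (g k (k ^ (m + 1)) : ℝ) * ((k : ℝ) ^ k - k) =
      (k * g k (k ^ m) + ((k : ℝ) ^ m) ^ k) * ((k : ℝ) ^ k - k) := by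
    rw [h2, h4, pow_succ, add_mul, mul_assoc, h1]; ring
  exact_mod_cast mul_right_cancel₀ hpos.ne' h3

/-! ### Consistent tuples of a labeling -/

/-- Summing a product of functions of one coordinate over all tuples with two prescribed entries. -/
theorem sum_ite_prod_pair {V : Type*} [Fintype V] [DecidableEq V] {k : ℕ} {i j : Fin k}
    (hij : i ≠ j) (c : Fin k → V → ℝ) (u v : V) :
    ∑ f : Fin k → V, (if f i = u ∧ f j = v then ∏ n, c n (f n) else 0) =
      c i u * c j v * ∏ n ∈ (Finset.univ.erase i).erase j, ∑ w, c n w := by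
  set d : Fin k → V → ℝ := fun n w =>
    if n = i then (if w = u then c i u else 0)
    else if n = j then (if w = v then c j v else 0) else c n w with hd
  have hsplit : ∀ a : Fin k → ℝ, ∏ n, a n =
      a i * (a j * ∏ n ∈ (Finset.univ.erase i).erase j, a n) := fun a => by
    rw [Finset.mul_prod_erase (Finset.univ.erase i) a (by simp [hij.symm]),
      Finset.mul_prod_erase _ a (by simp)]
  have hrest : ∀ n ∈ (Finset.univ.erase i).erase j, d n = c n := by
    intro n hn
    simp only [Finset.mem_erase, Finset.mem_univ, and_true] at hn
    funext w
    simp [hd, hn.1, hn.2]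
  have h1 : ∀ f : Fin k → V, (if f i = u ∧ f j = v then ∏ n, c n (f n) else 0) =
      ∏ n, d n (f n) := by
    intro f
    have hp : ∏ n ∈ (Finset.univ.erase i).erase j, d n (f n) =
        ∏ n ∈ (Finset.univ.erase i).erase j, c n (f n) :=
      Finset.prod_congr rfl fun n hn => by rw [hrest n hn]
    rw [hsplit fun n => d n (f n), hsplit fun n => c n (f n), hp]
    by_cases h1 : f i = u <;> by_cases h2 : f j = v <;> simp [hd, h1, h2, hij.symm]
  rw [Finset.sum_congr rfl fun f _ => h1 f]
  have h2 := Finset.prod_univ_sum (fun _ : Fin k => (Finset.univ : Finset V)) d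
  rw [Fintype.piFinset_univ] at h2
  rw [← h2, hsplit, Finset.prod_congr rfl fun n hn => by rw [hrest n hn]]
  simp [hd, hij.symm, mul_assoc]

theorem sum_prod_pair {V : Type*} [Fintype V] [DecidableEq V] {k : ℕ} {i j : Fin k}
    (hij : i ≠ j) (c : Fin k → V → ℝ) (G : V → V → ℝ) :
    ∑ f : Fin k → V, G (f i) (f j) * ∏ n, c n (f n) =
      (∑ u, ∑ v, G u v * (c i u * c j v)) *
        ∏ n ∈ (Finset.univ.erase i).erase j, ∑ w, c n w := by
  have h1 : ∀ f : Fin k → V, G (f i) (f j) * ∏ n, c n (f n) =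
      ∑ u, ∑ v, G u v * (if f i = u ∧ f j = v then ∏ n, c n (f n) else 0) := by
    intro f
    simp [ite_and]
  rw [Finset.sum_congr rfl fun f _ => h1 f, Finset.sum_comm, Finset.sum_mul]
  refine Finset.sum_congr rfl fun u _ => ?_
  rw [Finset.sum_comm, Finset.sum_mul]
  refine Finset.sum_congr rfl fun v _ => ?_
  rw [← Finset.mul_sum, sum_ite_prod_pair hij]
  ring

theorem sum_prod_two_pairs {V : Type*} [Fintype V] [DecidableEq V] {k : ℕ} {i j l m : Fin k}
    (hij : i ≠ j) (hlm : l ≠ m) (hil : i ≠ l) (him : i ≠ m) (hjl : j ≠ l) (hjm : j ≠ m)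
    (c : Fin k → V → ℝ) (G H : V → V → ℝ) :
    ∑ f : Fin k → V, G (f i) (f j) * H (f l) (f m) * ∏ n, c n (f n) =
      (∑ u, ∑ v, G u v * (c i u * c j v)) * (∑ u, ∑ v, H u v * (c l u * c m v)) *
        ∏ n ∈ (((Finset.univ.erase i).erase j).erase l).erase m, ∑ w, c n w := by
  have hmem : ∀ a : Fin k → ℝ, ∏ n ∈ (Finset.univ.erase l).erase m, a n =
      a i * (a j * ∏ n ∈ (((Finset.univ.erase i).erase j).erase l).erase m, a n) := fun a => by
    have h : (((Finset.univ.erase i).erase j).erase l).erase m =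
        (((Finset.univ.erase l).erase m).erase i).erase j := by
      ext n
      simp only [Finset.mem_erase, Finset.mem_univ, and_true]
      tauto
    rw [h, Finset.mul_prod_erase (((Finset.univ.erase l).erase m).erase i) a
      (by simp [hij.symm, hjl, hjm]), Finset.mul_prod_erase _ a (by simp [hil, him])]
  set d : V → V → Fin k → V → ℝ := fun u v n w =>
    if n = i then (if w = u then c i u else 0)
    else if n = j then (if w = v then c j v else 0) else c n w with hd
  have hsplit : ∀ a : Fin k → ℝ, ∏ n, a n =
      a i * (a j * ∏ n ∈ (Finset.univ.erase i).erase j, a n) := fun a => by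
    rw [Finset.mul_prod_erase (Finset.univ.erase i) a (by simp [hij.symm]),
      Finset.mul_prod_erase _ a (by simp)]
  have hrest : ∀ u v, ∀ n ∈ (Finset.univ.erase i).erase j, d u v n = c n := by
    intro u v n hn
    simp only [Finset.mem_erase, Finset.mem_univ, and_true] at hn
    funext w
    simp [hd, hn.1, hn.2]
  have h1 : ∀ f : Fin k → V, G (f i) (f j) * H (f l) (f m) * ∏ n, c n (f n) =
      ∑ u, ∑ v, G u v * (H (f l) (f m) * ∏ n, d u v n (f n)) := by
    intro f
    have h2 : ∀ u v, ∏ n, d u v n (f n) =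
        if f i = u then (if f j = v then ∏ n, c n (f n) else 0) else 0 := by
      intro u v
      rw [hsplit fun n => d u v n (f n), hsplit fun n => c n (f n),
        Finset.prod_congr rfl fun n hn => by rw [hrest u v n hn]]
      by_cases h1 : f i = u <;> by_cases h2 : f j = v <;> simp [hd, h1, h2, hij.symm]
    simp only [h2]
    simp [mul_assoc]
  rw [Finset.sum_congr rfl fun f _ => h1 f, Finset.sum_comm, Finset.sum_mul, Finset.sum_mul]
  refine Finset.sum_congr rfl fun u _ => ?_
  rw [Finset.sum_comm, Finset.sum_mul, Finset.sum_mul]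
  refine Finset.sum_congr rfl fun v _ => ?_
  have hdl : d u v l = c l := hrest u v l (by simp [hil.symm, hjl.symm])
  have hdm : d u v m = c m := hrest u v m (by simp [him.symm, hjm.symm])
  have h5 : ∏ n ∈ (((Finset.univ.erase i).erase j).erase l).erase m, ∑ w, d u v n w =
      ∏ n ∈ (((Finset.univ.erase i).erase j).erase l).erase m, ∑ w, c n w :=
    Finset.prod_congr rfl fun n hn => by
      rw [hrest u v n (Finset.mem_of_mem_erase (Finset.mem_of_mem_erase hn))]
  have h3 : ∑ w, d u v i w = c i u := by simp [hd]
  have h4 : ∑ w, d u v j w = c j v := by simp [hd, hij.symm]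
  rw [← Finset.mul_sum, sum_prod_pair hlm, hmem, hdl, hdm, h5, h3, h4]
  ring

/-- `ℓ u v = (i, j)` means that `u` may play the part `i` and `v` the part `j`; a labeling is a map
that says the same about `(v, u)`. -/
def IsLabeling {V : Type*} {k : ℕ} (ℓ : V → V → Fin k × Fin k) : Prop :=
  ∀ u v, ℓ v u = (ℓ u v).swap

/-- A tuple in which the `i`-th vertex plays the part `i` towards all the other ones. -/
def Consistent {V : Type*} {k : ℕ} (ℓ : V → V → Fin k × Fin k) (f : Fin k → V) : Prop :=
  ∀ i j, i ≠ j → ℓ (f i) (f j) = (i, j)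

theorem Consistent.injective {V : Type*} {k : ℕ} {ℓ : V → V → Fin k × Fin k} (hℓ : IsLabeling ℓ)
    {f : Fin k → V} (hf : Consistent ℓ f) : Function.Injective f := by
  intro i j hij
  by_contra hne
  have h1 := hf i j hne
  have h2 := hℓ (f i) (f j)
  rw [h1, ← hij] at h2
  rw [← hij] at h1
  rw [h1] at h2
  exact hne (congrArg Prod.fst h2)

open Classical in
/-- The total weight of the consistent tuples, as a polynomial in the vertex weights. -/
noncomputable def copies {V : Type*} [Fintype V] {k : ℕ} (ℓ : V → V → Fin k × Fin k)
    (x : V → ℝ) : ℝ :=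
  ∑ f : Fin k → V with Consistent ℓ f, ∏ i, x (f i)

open Classical in
/-- The weight of the consistent tuples in which `v` plays the part `i`. -/
noncomputable def roleWeight {V : Type*} [Fintype V] {k : ℕ} (ℓ : V → V → Fin k × Fin k)
    (x : V → ℝ) (i : Fin k) (v : V) : ℝ :=
  ∑ f : Fin k → V with Consistent ℓ f ∧ f i = v, ∏ i, x (f i)

open Classical in
/-- The weight of the vertices `u` such that the label of `(v, u)` is `(i, j)`. -/
noncomputable def labelWeight {V : Type*} [Fintype V] {k : ℕ} (ℓ : V → V → Fin k × Fin k)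
    (x : V → ℝ) (i j : Fin k) (v : V) : ℝ :=
  ∑ u with ℓ v u = (i, j), x u

/-- The weight of the vertices towards which `v` plays the part `i`. -/
noncomputable def partWeight {V : Type*} [Fintype V] {k : ℕ} (ℓ : V → V → Fin k × Fin k)
    (x : V → ℝ) (i : Fin k) (v : V) : ℝ :=
  ∑ j ∈ Finset.univ.erase i, labelWeight ℓ x i j v

section
variable {V : Type*} [Fintype V] {k : ℕ} {ℓ : V → V → Fin k × Fin k} {x : V → ℝ}

theorem labelWeight_nonneg (hx : ∀ v, 0 ≤ x v) (i j : Fin k) (v : V) :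
    0 ≤ labelWeight ℓ x i j v := Finset.sum_nonneg fun u _ => hx u

theorem partWeight_nonneg (hx : ∀ v, 0 ≤ x v) (i : Fin k) (v : V) :
    0 ≤ partWeight ℓ x i v := Finset.sum_nonneg fun j _ => labelWeight_nonneg hx i j v

theorem sum_partWeight_add_le (hℓ : IsLabeling ℓ) (hx : ∀ v, 0 ≤ x v) (v : V) :
    ∑ i, partWeight ℓ x i v + x v ≤ ∑ u, x u := by
  classical
  have h1 : ∑ i, partWeight ℓ x i v = ∑ u, if (ℓ v u).1 ≠ (ℓ v u).2 then x u else 0 := by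
    simp only [partWeight, labelWeight, Finset.sum_filter]
    rw [Finset.sum_congr rfl fun i _ => Finset.sum_comm, Finset.sum_comm]
    refine Finset.sum_congr rfl fun u _ => ?_
    obtain ⟨a, b⟩ := ℓ v u
    have : ∀ i : Fin k, ∑ j ∈ Finset.univ.erase i, (if (a, b) = (i, j) then x u else 0) =
        if a = i then (if a ≠ b then x u else 0) else 0 := by
      intro i
      by_cases h : a = i
      · subst h
        simp [eq_comm]
      · simp [h]
    rw [Finset.sum_congr rfl fun i _ => this i]
    simp
  have h2 : x v = ∑ u, if u = v then x u else 0 := by simp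
  rw [h1]
  conv_lhs => rw [h2]
  rw [← Finset.sum_add_distrib]
  refine Finset.sum_le_sum fun u _ => ?_
  by_cases huv : u = v
  · subst huv
    have h3 : (ℓ u u).1 = (ℓ u u).2 := by
      have := congrArg Prod.fst (hℓ u u)
      simpa using this
    simp [h3]
  · simp only [huv, if_false, add_zero]
    split_ifs
    · exact le_rfl
    · exact hx u

open Classical in
theorem pair_weight_le (hx : ∀ v, 0 ≤ x v) {i j : Fin k} (hij : i ≠ j) (u v : V) :
    ∑ f : Fin k → V with Consistent ℓ f ∧ f i = u ∧ f j = v, ∏ n, x (f n) ≤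
      x u * x v * ∏ n ∈ (Finset.univ.erase i).erase j, labelWeight ℓ x i n u := by
  set c : Fin k → V → ℝ := fun n w =>
    if n = i ∨ n = j then x w else if ℓ u w = (i, n) then x w else 0 with hc
  have h := sum_ite_prod_pair hij c u v
  have h1 : ∏ n ∈ (Finset.univ.erase i).erase j, ∑ w, c n w =
      ∏ n ∈ (Finset.univ.erase i).erase j, labelWeight ℓ x i n u := by
    refine Finset.prod_congr rfl fun n hn => ?_
    simp only [Finset.mem_erase, Finset.mem_univ, and_true] at hn
    simp [hc, hn.1, hn.2, labelWeight, Finset.sum_filter]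
  rw [h1] at h
  have h2 : c i u * c j v = x u * x v := by simp [hc]
  rw [h2] at h
  rw [← h, Finset.sum_filter]
  refine Finset.sum_le_sum fun f _ => ?_
  have hc0 : ∀ n w, 0 ≤ c n w := by
    intro n w
    simp only [hc]
    split_ifs <;> simp [hx w]
  by_cases hf : f i = u ∧ f j = v
  · by_cases hcons : Consistent ℓ f
    · rw [if_pos ⟨hcons, hf⟩, if_pos hf]
      refine le_of_eq (Finset.prod_congr rfl fun n _ => ?_)
      by_cases hn : n = i ∨ n = j
      · simp [hc, hn]
      · have h3 := hcons i n (fun h => hn (Or.inl h.symm))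
        rw [hf.1] at h3
        simp [hc, h3]
    · rw [if_neg (fun h => hcons h.1), if_pos hf]
      exact Finset.prod_nonneg fun n _ => hc0 n _
  · rw [if_neg (fun h => hf h.2), if_neg hf]

open Classical in
theorem roleWeight_le (hk : 2 ≤ k) (hx : ∀ v, 0 ≤ x v) (i : Fin k) (v : V) :
    roleWeight ℓ x i v ≤ x v * (partWeight ℓ x i v / (k - 1 : ℕ)) ^ (k - 1) := by
  obtain ⟨j, hj⟩ : ∃ j : Fin k, i ≠ j := by
    have : Nontrivial (Fin k) := Fin.nontrivial_iff_two_le.mpr hk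
    obtain ⟨j, hj⟩ := exists_ne i
    exact ⟨j, hj.symm⟩
  have h1 : roleWeight ℓ x i v ≤ x v * ∏ n ∈ Finset.univ.erase i, labelWeight ℓ x i n v := by
    rw [← Finset.mul_prod_erase (Finset.univ.erase i) _ (Finset.mem_erase.mpr ⟨hj.symm,
      Finset.mem_univ _⟩), labelWeight, Finset.sum_mul, Finset.mul_sum]
    have h2 : roleWeight ℓ x i v ≤ ∑ w with ℓ v w = (i, j),
        ∑ f : Fin k → V with Consistent ℓ f ∧ f i = v ∧ f j = w, ∏ n, x (f n) := by
      rw [roleWeight, ← Finset.sum_fiberwise_of_maps_to (g := fun f => f j)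
        (t := Finset.univ.filter fun w => ℓ v w = (i, j))]
      · refine le_of_eq (Finset.sum_congr rfl fun w _ => ?_)
        rw [Finset.filter_filter]
        simp only [and_assoc]
      · intro f hf
        simp only [Finset.mem_filter, Finset.mem_univ, true_and] at hf ⊢
        rw [← hf.2]
        exact hf.1 i j hj
    refine h2.trans (Finset.sum_le_sum fun w _ => ?_)
    rw [← mul_assoc]
    exact pair_weight_le hx hj v w
  refine h1.trans (mul_le_mul_of_nonneg_left ?_ (hx v))
  have h3 := prod_le_mean_pow (Finset.univ.erase i) (fun n => labelWeight ℓ x i n v)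
    (fun n _ => labelWeight_nonneg hx i n v)
  rw [Finset.card_erase_of_mem (Finset.mem_univ i), Finset.card_univ, Fintype.card_fin] at h3
  exact h3

/-- Two vertices of a pair with label `(i, j)` lie together in few consistent tuples if the first
one plays the part `i` towards few vertices only. -/
theorem pair_weight_le_pow (hk : 3 ≤ k) (hx : ∀ v, 0 ≤ x v) {i j : Fin k} (hij : i ≠ j) (u v : V)
    [DecidablePred fun f : Fin k → V => Consistent ℓ f ∧ f i = u ∧ f j = v] :
    ∑ f : Fin k → V with Consistent ℓ f ∧ f i = u ∧ f j = v, ∏ n, x (f n) ≤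
      x u * x v * (partWeight ℓ x i u / (k - 2 : ℕ)) ^ (k - 2) := by
  have h := pair_weight_le (ℓ := ℓ) hx hij u v
  have h3 := prod_le_mean_pow ((Finset.univ.erase i).erase j) (fun n => labelWeight ℓ x i n u)
    (fun n _ => labelWeight_nonneg hx i n u)
  have hcard : ((Finset.univ.erase i).erase j).card = k - 2 := by
    rw [Finset.card_erase_of_mem (by simp [hij.symm]),
      Finset.card_erase_of_mem (Finset.mem_univ i), Finset.card_univ, Fintype.card_fin]
    omega
  rw [hcard] at h3
  have h4 : ∑ n ∈ (Finset.univ.erase i).erase j, labelWeight ℓ x i n u ≤ partWeight ℓ x i u :=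
    Finset.sum_le_sum_of_subset_of_nonneg (Finset.erase_subset _ _)
      fun n _ _ => labelWeight_nonneg hx i n u
  refine le_trans (le_of_eq ?_) (h.trans (mul_le_mul_of_nonneg_left (h3.trans ?_)
    (mul_nonneg (hx u) (hx v))))
  · congr 1
    ext f
    simp
  · refine pow_le_pow_left₀ (div_nonneg (Finset.sum_nonneg fun n _ =>
      labelWeight_nonneg hx i n u) (Nat.cast_nonneg _)) ?_ _
    gcongr

theorem copies_smul (a : ℝ) : copies ℓ (fun v => a * x v) = a ^ k * copies ℓ x := by
  simp only [copies, Finset.mul_sum, Finset.prod_mul_distrib, Finset.prod_const, Finset.card_univ,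
    Fintype.card_fin]

theorem continuous_copies : Continuous (copies ℓ : (V → ℝ) → ℝ) := by
  unfold copies
  fun_prop

end

/-! ### The first order condition at a maximum -/

open Classical in
theorem sum_roleWeight {V : Type*} [Fintype V] {k : ℕ} {ℓ : V → V → Fin k × Fin k}
    (hℓ : IsLabeling ℓ) (x : V → ℝ) (v : V) :
    ∑ i, roleWeight ℓ x i v =
      ∑ f : Fin k → V with Consistent ℓ f ∧ ∃ i, f i = v, ∏ n, x (f n) := by
  simp only [roleWeight, Finset.sum_filter]
  rw [Finset.sum_comm]
  refine Finset.sum_congr rfl fun f _ => ?_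
  by_cases hf : Consistent ℓ f
  · by_cases hv : ∃ i, f i = v
    · obtain ⟨i, hi⟩ := hv
      rw [if_pos ⟨hf, i, hi⟩, Finset.sum_eq_single i]
      · rw [if_pos ⟨hf, hi⟩]
      · intro j _ hji
        rw [if_neg]
        rintro ⟨-, hj⟩
        exact hji (hf.injective hℓ (hj.trans hi.symm))
      · simp
    · rw [if_neg (fun h => hv h.2)]
      refine Finset.sum_eq_zero fun i _ => ?_
      rw [if_neg]
      rintro ⟨-, hi⟩
      exact hv ⟨i, hi⟩
  · simp [hf]

open Classical in
/-- Rescaling the weight of one vertex changes `copies` linearly. -/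
theorem copies_update_mul {V : Type*} [Fintype V] {k : ℕ} {ℓ : V → V → Fin k × Fin k}
    (hℓ : IsLabeling ℓ) (x : V → ℝ) (v : V) (t : ℝ) :
    copies ℓ (fun u => if u = v then (1 + t) * x u else x u) =
      copies ℓ x + t * ∑ i, roleWeight ℓ x i v := by
  rw [sum_roleWeight hℓ, copies, copies, Finset.mul_sum, ← Finset.filter_filter,
    Finset.sum_filter (s := Finset.univ.filter (Consistent ℓ)), ← Finset.sum_add_distrib]
  refine Finset.sum_congr rfl fun f hf => ?_
  simp only [Finset.mem_filter, Finset.mem_univ, true_and] at hf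
  by_cases hv : ∃ i, f i = v
  · obtain ⟨i, hi⟩ := hv
    rw [if_pos ⟨i, hi⟩, ← Finset.mul_prod_erase Finset.univ _ (Finset.mem_univ i),
      ← Finset.mul_prod_erase Finset.univ (fun n => x (f n)) (Finset.mem_univ i), if_pos hi]
    have : ∏ n ∈ Finset.univ.erase i, (if f n = v then (1 + t) * x (f n) else x (f n)) =
        ∏ n ∈ Finset.univ.erase i, x (f n) := by
      refine Finset.prod_congr rfl fun n hn => if_neg ?_
      rw [← hi]
      exact fun h => (Finset.ne_of_mem_erase hn) (hf.injective hℓ h)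
    rw [this]
    ring
  · rw [if_neg hv, add_zero]
    exact Finset.prod_congr rfl fun n _ => if_neg fun h => hv ⟨n, h⟩

/-- If `copies ℓ x + c * ∑ x v ^ k ≤ c * (∑ x v) ^ k` fails for some weights supported in `U`, but
not for any supported in a smaller set, then the maximum of the left-hand side on the simplex is
attained at positive weights, and the first order condition bounds the degrees from below. -/
theorem exists_extremal {V : Type*} [Fintype V] {k : ℕ} (hk : 2 ≤ k)
    {ℓ : V → V → Fin k × Fin k} (hℓ : IsLabeling ℓ) {c : ℝ} (U : Finset V)
    (ih : ∀ U' ⊂ U, ∀ x : V → ℝ, (∀ v, 0 ≤ x v) → (∀ v ∉ U', x v = 0) →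
      copies ℓ x + c * ∑ v, x v ^ k ≤ c * (∑ v, x v) ^ k)
    {x₀ : V → ℝ} (hx₀ : ∀ v, 0 ≤ x₀ v) (hU₀ : ∀ v ∉ U, x₀ v = 0)
    (hviol : c * (∑ v, x₀ v) ^ k < copies ℓ x₀ + c * ∑ v, x₀ v ^ k) :
    ∃ x : V → ℝ, (∀ v, 0 ≤ x v) ∧ (∀ v ∉ U, x v = 0) ∧ (∀ v ∈ U, 0 < x v) ∧ ∑ v, x v = 1 ∧
      c < copies ℓ x + c * ∑ v, x v ^ k ∧
      ∀ v ∈ U, k * c * x v * (1 - x v ^ (k - 1)) < ∑ i, roleWeight ℓ x i v := by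
  classical
  have hk0 : k ≠ 0 := by omega
  set F : (V → ℝ) → ℝ := fun x => copies ℓ x + c * ∑ v, x v ^ k with hF
  have hFsmul : ∀ (a : ℝ) (x : V → ℝ), F (fun v => a * x v) = a ^ k * F x := by
    intro a x
    simp only [hF, copies_smul, mul_pow, ← Finset.mul_sum]
    ring
  have hFcont : Continuous F := by
    have := continuous_copies (ℓ := ℓ)
    simp only [hF]
    fun_prop
  have hzero : F (fun _ => 0) = 0 := by
    have := hFsmul 0 (fun _ => 0)
    simpa [hk0] using this
  have hS₀ : 0 < ∑ v, x₀ v := by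
    rcases (Finset.sum_nonneg fun v (_ : v ∈ Finset.univ) => hx₀ v).lt_or_eq with h | h
    · exact h
    · have h2 := (Finset.sum_eq_zero_iff_of_nonneg fun v _ => hx₀ v).mp h.symm
      have h3 : x₀ = fun _ => 0 := funext fun v => h2 v (Finset.mem_univ v)
      change _ < F x₀ at hviol
      rw [h3, hzero] at hviol
      simp [hk0] at hviol
  set K : Set (V → ℝ) := stdSimplex ℝ V ∩ {x | ∀ v ∉ U, x v = 0} with hK
  have hKc : IsCompact K := by
    refine (isCompact_stdSimplex ℝ V).inter_right ?_
    have : {x : V → ℝ | ∀ v ∉ U, x v = 0} = ⋂ v ∈ {v | v ∉ U}, {x | x v = 0} := by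
      ext x; simp
    rw [this]
    exact isClosed_biInter fun v _ => isClosed_eq (continuous_apply v) continuous_const
  set x₁ : V → ℝ := fun v => (∑ v, x₀ v)⁻¹ * x₀ v with hx₁
  have hx₁K : x₁ ∈ K := by
    refine ⟨⟨fun v => mul_nonneg (inv_nonneg.mpr hS₀.le) (hx₀ v), ?_⟩, fun v hv => ?_⟩
    · rw [hx₁, ← Finset.mul_sum, inv_mul_cancel₀ hS₀.ne']
    · simp [hx₁, hU₀ v hv]
  have hx₁F : c < F x₁ := by
    have hpow := pow_pos hS₀ k
    rw [hx₁, hFsmul, inv_pow, inv_mul_eq_div, lt_div_iff₀ hpow]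
    exact hviol
  obtain ⟨x, hxK, hmax⟩ := hKc.exists_isMaxOn ⟨x₁, hx₁K⟩ hFcont.continuousOn
  have hx0 : ∀ v, 0 ≤ x v := hxK.1.1
  have hx1 : ∑ v, x v = 1 := hxK.1.2
  have hxU : ∀ v ∉ U, x v = 0 := hxK.2
  have hμ : c < F x := hx₁F.trans_le (hmax hx₁K)
  have hhom : ∀ y : V → ℝ, (∀ v, 0 ≤ y v) → (∀ v ∉ U, y v = 0) → F y ≤ F x * (∑ v, y v) ^ k := by
    intro y hy hyU
    rcases (Finset.sum_nonneg fun v (_ : v ∈ Finset.univ) => hy v).lt_or_eq with h | h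
    · have h1 : (fun v => (∑ v, y v)⁻¹ * y v) ∈ K := by
        refine ⟨⟨fun v => mul_nonneg (inv_nonneg.mpr h.le) (hy v), ?_⟩, fun v hv => ?_⟩
        · rw [← Finset.mul_sum, inv_mul_cancel₀ h.ne']
        · simp [hyU v hv]
      have h2 := hmax h1
      simp only [Set.mem_ofPred_eq] at h2
      rwa [hFsmul, inv_pow, inv_mul_eq_div, div_le_iff₀ (pow_pos h k)] at h2
    · have h2 := (Finset.sum_eq_zero_iff_of_nonneg fun v _ => hy v).mp h.symm
      have h3 : y = fun _ => 0 := funext fun v => h2 v (Finset.mem_univ v)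
      rw [h3, hzero]
      simp [hk0]
  have hpos : ∀ v ∈ U, 0 < x v := by
    intro v hv
    rcases (hx0 v).lt_or_eq with h | h
    · exact h
    · exfalso
      have h1 := ih (U.erase v) (Finset.erase_ssubset hv) x hx0 (fun w hw => by
        by_cases hwv : w = v
        · rw [hwv, ← h]
        · exact hxU w fun hwU => hw (Finset.mem_erase.mpr ⟨hwv, hwU⟩))
      rw [hx1] at h1
      simp only [one_pow, mul_one] at h1
      exact absurd hμ (not_lt.mpr h1)
  refine ⟨x, hx0, hxU, hpos, hx1, hμ, fun v hv => ?_⟩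
  -- first order condition: the homogeneous inequality is tight at `t = 0` when the weight of `v` is
  -- multiplied by `1 + t`
  set S := ∑ i, roleWeight ℓ x i v with hS
  set h : ℝ → ℝ := fun t => F x * (1 + t * x v) ^ k -
    (copies ℓ x + t * S + c * (∑ u, x u ^ k + x v ^ k * ((1 + t) ^ k - 1))) with hh
  have hnonneg : ∀ t, -1 < t → 0 ≤ h t := by
    intro t ht
    have h1 := hhom (fun u => if u = v then (1 + t) * x u else x u) (fun u => by
        split_ifs
        · exact mul_nonneg (by linarith) (hx0 u)
        · exact hx0 u) (fun u hu => by
        rw [if_neg (fun huv : u = v => hu (huv ▸ hv))]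
        exact hxU u hu)
    have h2 : ∑ u, (if u = v then (1 + t) * x u else x u) = 1 + t * x v := by
      have : ∀ u, (if u = v then (1 + t) * x u else x u) = x u + if u = v then t * x u else 0 := by
        intro u; split_ifs <;> ring
      simp only [this, Finset.sum_add_distrib, hx1]
      simp
    have h3 : ∑ u, (if u = v then (1 + t) * x u else x u) ^ k =
        ∑ u, x u ^ k + x v ^ k * ((1 + t) ^ k - 1) := by
      have : ∀ u, (if u = v then (1 + t) * x u else x u) ^ k =
          x u ^ k + if u = v then x u ^ k * ((1 + t) ^ k - 1) else 0 := by
        intro u; split_ifs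
        · rw [mul_pow]; ring
        · ring
      simp only [this, Finset.sum_add_distrib]
      simp
    rw [h2] at h1
    simp only [hF] at h1
    rw [h3, copies_update_mul hℓ] at h1
    simp only [hh, hF, hS]
    linarith
  have h0 : h 0 = 0 := by simp [hh, hF]
  have hmin : IsLocalMin h 0 := by
    filter_upwards [lt_mem_nhds (show (-1 : ℝ) < 0 by norm_num)] with t ht
    rw [h0]
    exact hnonneg t ht
  have hderiv : HasDerivAt h (F x * (k * (1 + 0 * x v) ^ (k - 1) * (1 * x v)) -
      (0 + 1 * S + c * (0 + x v ^ k * (k * (1 + 0) ^ (k - 1) * 1)))) 0 := by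
    refine HasDerivAt.sub (HasDerivAt.const_mul _ ?_) (HasDerivAt.add (HasDerivAt.add
      (hasDerivAt_const _ _) ((hasDerivAt_id (0 : ℝ)).mul_const S)) (HasDerivAt.const_mul _
      (HasDerivAt.add (hasDerivAt_const _ _) (HasDerivAt.const_mul _
      (HasDerivAt.sub_const _ ?_)))))
    · exact (((hasDerivAt_id (0 : ℝ)).mul_const (x v)).const_add 1).pow k
    · exact ((hasDerivAt_id (0 : ℝ)).const_add 1).pow k
  have h1 := hmin.hasDerivAt_eq_zero hderiv
  simp only [zero_mul, add_zero, one_pow, mul_one, one_mul, zero_add] at h1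
  have h2 : x v ^ k = x v * x v ^ (k - 1) := by
    rw [← pow_succ']; congr 1; omega
  rw [h2] at h1
  have h3 : S = k * F x * x v - k * c * x v * x v ^ (k - 1) := by linarith
  rw [h3]
  have hkp : (0 : ℝ) < k := by exact_mod_cast Nat.pos_of_ne_zero hk0
  have h4 : k * c * x v < k * F x * x v := by
    have := hpos v hv
    gcongr
  linarith

/-! ### The dominant part of a vertex of large degree -/

theorem sum_pow_le_sum_pow {ι : Type*} (s : Finset ι) (a : ι → ℝ) (ha : ∀ i ∈ s, 0 ≤ a i) {n : ℕ}
    (hn : n ≠ 0) : ∑ i ∈ s, a i ^ n ≤ (∑ i ∈ s, a i) ^ n := by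
  classical
  induction s using Finset.induction_on with
  | empty => simp [hn]
  | insert i s hi ih =>
    rw [Finset.sum_insert hi, Finset.sum_insert hi]
    have h1 := ih fun j hj => ha j (Finset.mem_insert_of_mem hj)
    have h2 := pow_add_pow_le (ha i (Finset.mem_insert_self i s))
      (Finset.sum_nonneg fun j hj => ha j (Finset.mem_insert_of_mem hj)) hn
    linarith

/-- With `n = k - 1`, this makes the error term in the weight of the transversals at most a
twentieth of `k ^ (-k)`, for `k ≥ 5`. -/
theorem pow_mul_succ_le_pow_self {n : ℕ} (hn : 4 ≤ n) :
    20 * ((n : ℝ) + 1) * (21 / 20) ^ n ≤ (n : ℝ) ^ n := by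
  induction n, hn using Nat.le_induction with
  | base => norm_num
  | succ n hn ih =>
    have hn' : (4 : ℝ) ≤ n := by exact_mod_cast hn
    have h1 : (n : ℝ) ^ n ≤ ((n : ℝ) + 1) ^ n := pow_le_pow_left₀ (by linarith) (by linarith) n
    have h2 : (0 : ℝ) < (21 / 20) ^ n := by positivity
    push_cast
    calc 20 * ((n : ℝ) + 1 + 1) * (21 / 20) ^ (n + 1)
        = (21 / 20) ^ n * (20 * ((n + 2) * (21 / 20))) := by ring
      _ ≤ (21 / 20) ^ n * (20 * ((n + 1) * (n + 1))) := by
          refine mul_le_mul_of_nonneg_left ?_ h2.le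
          nlinarith
      _ = (20 * ((n : ℝ) + 1) * (21 / 20) ^ n) * (n + 1) := by ring
      _ ≤ (n + 1) ^ n * (n + 1) := mul_le_mul_of_nonneg_right (ih.trans h1) (by linarith)
      _ = _ := by rw [pow_succ]

/-- With `n = k - 2`, this is the comparison of the number of consistent tuples through a bad pair
with the number of transversals through it, for `k ≥ 5`. -/
theorem pow_mul_cube_le_pow_succ {n : ℕ} (hn : 3 ≤ n) :
    (21 / 20) ^ n * ((n : ℝ) + 2) ^ 3 * (n + 1) ≤ 38 / 5 * (n : ℝ) ^ (n + 1) := by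
  induction n, hn using Nat.le_induction with
  | base => norm_num
  | succ n hn ih =>
    have hn' : (3 : ℝ) ≤ n := by exact_mod_cast hn
    have h1 : (n : ℝ) ^ (n + 1) ≤ ((n : ℝ) + 1) ^ (n + 1) :=
      pow_le_pow_left₀ (by linarith) (by linarith) _
    have h2 : (0 : ℝ) < (21 / 20) ^ n := by positivity
    push_cast
    calc (21 / 20) ^ (n + 1) * ((n : ℝ) + 1 + 2) ^ 3 * (n + 1 + 1)
        = (21 / 20) ^ n * (21 / 20 * ((n : ℝ) + 3) ^ 3 * (n + 2)) := by ring
      _ ≤ (21 / 20) ^ n * (((n : ℝ) + 2) ^ 3 * (n + 1) * (n + 1)) := by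
          refine mul_le_mul_of_nonneg_left ?_ h2.le
          obtain ⟨m, hm⟩ : ∃ m : ℝ, (n : ℝ) = m + 3 := ⟨n - 3, by ring⟩
          have hm0 : 0 ≤ m := by linarith
          rw [hm, ← sub_nonneg]
          ring_nf
          positivity
      _ = ((21 / 20) ^ n * ((n : ℝ) + 2) ^ 3 * (n + 1)) * (n + 1) := by ring
      _ ≤ 38 / 5 * (n + 1) ^ (n + 1) * (n + 1) :=
          mul_le_mul_of_nonneg_right (ih.trans (by linarith)) (by linarith)
      _ = _ := by rw [pow_succ _ (n + 1)]; ring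

theorem mul_pow_pred_le_pow_self {n : ℕ} (hn : 3 ≤ n) :
    ((n : ℝ) + 1) * (21 / 20) ^ (n - 1) ≤ (n : ℝ) ^ n := by
  rcases hn.eq_or_lt with rfl | h
  · norm_num
  · have h1 := pow_mul_succ_le_pow_self (n := n) h
    have h2 : ((21 : ℝ) / 20) ^ (n - 1) ≤ (21 / 20) ^ n :=
      pow_le_pow_right₀ (by norm_num) (by omega)
    have h3 : (0 : ℝ) ≤ (n + 1) * (21 / 20) ^ n := by positivity
    have h4 : ((n : ℝ) + 1) * (21 / 20) ^ (n - 1) ≤ (n + 1) * (21 / 20) ^ n := by gcongr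
    linarith

/-- At the threshold `21 / (20 k)`, slightly above `1 / k`, two parts do not suffice for the degree
forced by the first order condition. Here `k = n + 1`. -/
theorem pow_add_pow_le_threshold {n : ℕ} (hn : 3 ≤ n) :
    (21 / (20 * ((n : ℝ) + 1))) ^ n + (1 - 21 / (20 * ((n : ℝ) + 1))) ^ n ≤
      (n / ((n : ℝ) + 1)) ^ n := by
  have hn' : (3 : ℝ) ≤ n := by exact_mod_cast hn
  have hn0 : (0 : ℝ) < n := by linarith
  have e1 : 21 / (20 * ((n : ℝ) + 1)) = (n / (n + 1)) * (21 / (20 * n)) := by field_simp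
  have e2 : 1 - 21 / (20 * ((n : ℝ) + 1)) = (n / (n + 1)) * (1 - 1 / (20 * n)) := by
    field_simp; ring
  rw [e2, e1, mul_pow, mul_pow, ← mul_add]
  refine mul_le_of_le_one_right (by positivity) ?_
  have ha : 1 / (20 * (n : ℝ)) ≤ 1 / 60 := by
    apply one_div_le_one_div_of_le <;> linarith
  have ha0 : 0 < 1 / (20 * (n : ℝ)) := by positivity
  have h1 : (1 - 1 / (20 * (n : ℝ))) ^ n ≤ 20 / 21 := by
    have h2 : 1 + (n : ℝ) * (1 / (20 * n)) ≤ (1 + 1 / (20 * n)) ^ n :=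
      one_add_mul_le_pow (by linarith) n
    have h3 : 1 + (n : ℝ) * (1 / (20 * n)) = 21 / 20 := by field_simp; norm_num
    have h4 : (1 - 1 / (20 * (n : ℝ))) ^ n * (1 + 1 / (20 * n)) ^ n ≤ 1 := by
      rw [← mul_pow]
      refine pow_le_one₀ ?_ ?_ <;> nlinarith
    have h5 : (0 : ℝ) ≤ (1 - 1 / (20 * (n : ℝ))) ^ n := pow_nonneg (by linarith) n
    have h6 := mul_le_mul_of_nonneg_left h2 h5
    rw [h3] at h6
    linarith
  have h2 : (21 / (20 * (n : ℝ))) ^ n ≤ 343 / 8000 := by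
    have h3 : 21 / (20 * (n : ℝ)) ≤ 7 / 20 := by
      rw [div_le_div_iff₀ (by positivity) (by norm_num)]; linarith
    calc (21 / (20 * (n : ℝ))) ^ n ≤ (7 / 20) ^ n := pow_le_pow_left₀ (by positivity) h3 n
      _ ≤ (7 / 20) ^ 3 := pow_le_pow_of_le_one (by norm_num) (by norm_num) hn
      _ = _ := by norm_num
  linarith

/-- A vertex of large degree plays one part towards almost all vertices: the sum of the
`(A i / n) ^ n` bounds its degree, so by convexity `A` is concentrated on one index. -/
theorem exists_dominant {n : ℕ} (hn : 3 ≤ n) (A : Fin (n + 1) → ℝ) (hA : ∀ i, 0 ≤ A i) {x : ℝ}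
    (hx : 0 ≤ x) (hsum : ∑ i, A i + x ≤ 1)
    (hdeg : (1 - x ^ n) / (((n : ℝ) + 1) ^ n - 1) < ∑ i, (A i / n) ^ n) :
    ∃ i, 1 - 21 / (20 * ((n : ℝ) + 1)) ≤ A i := by
  have hn' : (3 : ℝ) ≤ n := by exact_mod_cast hn
  have hn0 : n ≠ 0 := by omega
  set y : ℝ := 21 / (20 * ((n : ℝ) + 1)) with hy
  have hy0 : 0 < y := by positivity
  have hy1 : y < 1 / 2 := by
    rw [hy, div_lt_div_iff₀ (by positivity) (by norm_num)]; linarith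
  set c : ℝ := (n / ((n : ℝ) + 1)) ^ n with hc
  have hc1 : c ≤ 1 := pow_le_one₀ (by positivity) (by rw [div_le_one (by positivity)]; linarith)
  have hA0 : 0 ≤ ∑ i, A i := Finset.sum_nonneg fun i _ => hA i
  have hx1 : x ≤ 1 := by linarith
  have hxn : x ^ n ≤ x := pow_le_of_le_one hx hx1 hn0
  have hxn0 : 0 ≤ x ^ n := pow_nonneg hx n
  have hD : (0 : ℝ) < ((n : ℝ) + 1) ^ n - 1 := by
    have := one_lt_pow₀ (show (1 : ℝ) < n + 1 by linarith) hn0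
    linarith
  have hkey : c * (1 - x ^ n) < ∑ i, A i ^ n := by
    simp only [div_pow, ← Finset.sum_div] at hdeg
    have hnn : (0 : ℝ) < (n : ℝ) ^ n := by positivity
    rw [lt_div_iff₀ hnn] at hdeg
    refine lt_of_le_of_lt ?_ hdeg
    rw [hc, div_pow, div_mul_eq_mul_div, div_mul_eq_mul_div, mul_comm]
    refine div_le_div_of_nonneg_left ?_ hD (by linarith)
    exact mul_nonneg (by linarith) hnn.le
  -- the largest entry is neither below `y` nor, by convexity, in `[y, 1 - y)`
  obtain ⟨i, -, hi⟩ := Finset.exists_max_image Finset.univ A Finset.univ_nonempty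
  refine ⟨i, ?_⟩
  by_contra! hlt
  rcases lt_or_ge (A i) y with h | h
  · have h1 : ∑ j, A j ^ n ≤ y ^ (n - 1) * ∑ j, A j := by
      rw [Finset.mul_sum]
      refine Finset.sum_le_sum fun j _ => ?_
      have h2 : A j ^ n = A j ^ (n - 1) * A j := by rw [← pow_succ]; congr 1; omega
      rw [h2]
      exact mul_le_mul_of_nonneg_right (pow_le_pow_left₀ (hA j)
        ((hi j (Finset.mem_univ j)).trans h.le) _) (hA j)
    have h2 : y ^ (n - 1) ≤ c := by
      have h3 := mul_pow_pred_le_pow_self hn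
      have h4 : y = (21 / 20) / ((n : ℝ) + 1) := by rw [hy]; field_simp
      have h5 : ((n : ℝ) + 1) ^ n = (n + 1) ^ (n - 1) * (n + 1) := by
        rw [← pow_succ]; congr 1; omega
      rw [h4, hc, div_pow (21 / 20 : ℝ), div_pow (n : ℝ), h5,
        div_le_div_iff₀ (by positivity) (by positivity)]
      calc ((21 : ℝ) / 20) ^ (n - 1) * ((n + 1) ^ (n - 1) * (n + 1))
          = (n + 1) ^ (n - 1) * ((n + 1) * (21 / 20) ^ (n - 1)) := by ring
        _ ≤ (n + 1) ^ (n - 1) * (n : ℝ) ^ n := by gcongr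
        _ = _ := by ring
    have h3 : y ^ (n - 1) * ∑ j, A j ≤ c * (1 - x) :=
      mul_le_mul h2 (by linarith) hA0 (by positivity)
    have h4 : c * (1 - x) ≤ c * (1 - x ^ n) :=
      mul_le_mul_of_nonneg_left (by linarith) (by positivity)
    linarith
  · have h1 : ∑ j, A j ^ n + x ^ n ≤ A i ^ n + (1 - A i) ^ n := by
      rw [← Finset.add_sum_erase _ _ (Finset.mem_univ i)]
      have h2 := sum_pow_le_sum_pow (Finset.univ.erase i) A (fun j _ => hA j) hn0
      have h3 := Finset.add_sum_erase Finset.univ A (Finset.mem_univ i)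
      have h4 := pow_add_pow_le (Finset.sum_nonneg fun j (_ : j ∈ Finset.univ.erase i) => hA j)
        hx hn0
      have h5 : (∑ j ∈ Finset.univ.erase i, A j + x) ^ n ≤ (1 - A i) ^ n :=
        pow_le_pow_left₀ (add_nonneg (Finset.sum_nonneg fun j _ => hA j) hx) (by linarith) n
      linarith
    have h2 : A i ^ n + (1 - A i) ^ n ≤ y ^ n + (1 - y) ^ n := by
      set θ : ℝ := (1 - y - A i) / (1 - 2 * y) with hθ
      have hd : 0 < 1 - 2 * y := by linarith
      have hθ0 : 0 ≤ θ := div_nonneg (by linarith) hd.le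
      have hθ1 : 0 ≤ 1 - θ := by
        rw [sub_nonneg, hθ, div_le_one hd]; linarith
      have hθm : θ * (1 - 2 * y) = 1 - y - A i := div_mul_cancel₀ _ hd.ne'
      have hconv := (convexOn_pow n : ConvexOn ℝ (Set.Ici 0) fun x : ℝ => x ^ n)
      have h3 := hconv.2 (Set.mem_Ici.mpr hy0.le) (Set.mem_Ici.mpr (by linarith : 0 ≤ 1 - y))
        hθ0 hθ1 (by ring)
      have h4 := hconv.2 (Set.mem_Ici.mpr (by linarith : 0 ≤ 1 - y)) (Set.mem_Ici.mpr hy0.le)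
        hθ0 hθ1 (by ring)
      simp only [smul_eq_mul] at h3 h4
      rw [show θ * y + (1 - θ) * (1 - y) = A i by linarith] at h3
      rw [show θ * (1 - y) + (1 - θ) * y = 1 - A i by linarith] at h4
      linarith
    have h3 := pow_add_pow_le_threshold hn
    have h4 : c * x ^ n ≤ x ^ n := mul_le_of_le_one_left hxn0 hc1
    linarith

/-! ### Transversal and mixed tuples -/

/-- A tuple of parts that is neither constant nor the identity has at least `k - 2` pairs of
positions with different parts, not both of which are the prescribed ones. -/
theorem two_mul_le_card_misplaced {k : ℕ} (ρ : Fin k → Fin k) (hid : ¬ ∀ i, ρ i = i)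
    (hconst : ¬ ∃ c, ∀ i, ρ i = c) :
    2 * (k - 2) ≤ (Finset.univ.filter fun p : Fin k × Fin k =>
      p.1 ≠ p.2 ∧ ρ p.1 ≠ ρ p.2 ∧ ¬ (ρ p.1 = p.1 ∧ ρ p.2 = p.2)).card := by
  push Not at hid hconst
  obtain ⟨i₀, hi₀⟩ := hid
  set c := ρ i₀ with hc
  obtain ⟨j₀, hj₀⟩ := hconst c
  -- all pairs in `P × J` and in `J × P` qualify
  set P : Finset (Fin k) := Finset.univ.filter fun i => ρ i = c ∧ i ≠ c with hP
  set J : Finset (Fin k) := Finset.univ.filter fun i => ρ i ≠ c with hJ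
  have hPpos : 1 ≤ P.card := Finset.card_pos.mpr ⟨i₀, by
    simp only [hP, Finset.mem_filter, Finset.mem_univ, true_and]
    exact ⟨hc.symm, hi₀.symm⟩⟩
  have hJpos : 1 ≤ J.card := Finset.card_pos.mpr ⟨j₀, by simp [hJ, hj₀]⟩
  have hPJ : k ≤ P.card + J.card + 1 := by
    have h : (Finset.univ : Finset (Fin k)) ⊆ insert c (P ∪ J) := by
      intro i _
      simp only [hP, hJ, Finset.mem_insert, Finset.mem_union, Finset.mem_filter, Finset.mem_univ,
        true_and]
      tauto
    have h1 := Finset.card_le_card h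
    rw [Finset.card_univ, Fintype.card_fin] at h1
    have h2 := Finset.card_insert_le c (P ∪ J)
    have h3 := Finset.card_union_le P J
    omega
  have hdisj : Disjoint (P ×ˢ J) (J ×ˢ P) := by
    rw [Finset.disjoint_left]
    rintro ⟨a, b⟩ h1 h2
    simp only [hP, hJ, Finset.mem_product, Finset.mem_filter, Finset.mem_univ, true_and] at h1 h2
    exact h2.1 h1.1.1
  have hsub : P ×ˢ J ∪ J ×ˢ P ⊆ Finset.univ.filter fun p : Fin k × Fin k =>
      p.1 ≠ p.2 ∧ ρ p.1 ≠ ρ p.2 ∧ ¬ (ρ p.1 = p.1 ∧ ρ p.2 = p.2) := by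
    rintro ⟨a, b⟩ h
    simp only [hP, hJ, Finset.mem_union, Finset.mem_product, Finset.mem_filter, Finset.mem_univ,
      true_and] at h ⊢
    rcases h with ⟨⟨h1, h2⟩, h3⟩ | ⟨h3, h1, h2⟩
    · exact ⟨fun h => h3 (h ▸ h1), fun h => h3 (h ▸ h1), fun h => h2 (h.1.symm.trans h1)⟩
    · exact ⟨fun h => h3 (h ▸ h1), fun h => h3 (h.trans h1), fun h => h2 (h.2.symm.trans h1)⟩
  have h1 := Finset.card_le_card hsub
  rw [Finset.card_union_of_disjoint hdisj, Finset.card_product, Finset.card_product] at h1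
  have h2 : k - 2 ≤ P.card * J.card := by
    obtain ⟨a, ha⟩ := Nat.exists_eq_add_of_le hPpos
    obtain ⟨b, hb⟩ := Nat.exists_eq_add_of_le hJpos
    rw [ha, hb] at hPJ ⊢
    have : (1 + a) * (1 + b) = 1 + a + b + a * b := by ring
    omega
  rw [mul_comm J.card] at h1
  omega

/-- A pair of vertices in different parts of `r` whose label differs from the one prescribed by
`r`. -/
def IsBad {V : Type*} {k : ℕ} (ℓ : V → V → Fin k × Fin k) (r : V → Fin k) (u v : V) : Prop :=
  r u ≠ r v ∧ ℓ u v ≠ (r u, r v)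

open Classical in
/-- The weight of the consistent tuples whose `i`-th vertex lies in the `i`-th part for all `i`. -/
noncomputable def transversalCopies {V : Type*} [Fintype V] {k : ℕ} (ℓ : V → V → Fin k × Fin k)
    (r : V → Fin k) (x : V → ℝ) : ℝ :=
  ∑ f : Fin k → V with Consistent ℓ f ∧ ∀ i, r (f i) = i, ∏ i, x (f i)

open Classical in
/-- The weight of the consistent tuples that are neither transversal nor inside one part. -/
noncomputable def mixedCopies {V : Type*} [Fintype V] {k : ℕ} (ℓ : V → V → Fin k × Fin k)
    (r : V → Fin k) (x : V → ℝ) : ℝ :=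
  ∑ f : Fin k → V with Consistent ℓ f ∧ (¬ ∀ i, r (f i) = i) ∧ ¬ ∃ c, ∀ i, r (f i) = c,
    ∏ i, x (f i)

open Classical in
/-- The weight of the ordered bad pairs. -/
noncomputable def badWeight {V : Type*} [Fintype V] {k : ℕ} (ℓ : V → V → Fin k × Fin k)
    (r : V → Fin k) (x : V → ℝ) : ℝ :=
  ∑ u, ∑ v, if IsBad ℓ r u v then x u * x v else 0

open Classical in
/-- The weight of the bad pairs between the parts `i` and `j`. -/
noncomputable def badWeightAt {V : Type*} [Fintype V] {k : ℕ} (ℓ : V → V → Fin k × Fin k)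
    (r : V → Fin k) (x : V → ℝ) (i j : Fin k) : ℝ :=
  ∑ u, ∑ v, if r u = i ∧ r v = j ∧ ℓ u v ≠ (i, j) then x u * x v else 0

/-- The weight of the `i`-th part. -/
noncomputable def classWeight {V : Type*} [Fintype V] {k : ℕ} (r : V → Fin k) (x : V → ℝ)
    (i : Fin k) : ℝ :=
  ∑ v, if r v = i then x v else 0

theorem prod_apply_nonneg {V : Type*} {k : ℕ} {x : V → ℝ} (hx : ∀ v, 0 ≤ x v) (f : Fin k → V) :
    0 ≤ ∏ i, x (f i) :=
  Finset.prod_nonneg fun i _ => hx (f i)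

section
variable {V : Type*} [Fintype V] {k : ℕ} {ℓ : V → V → Fin k × Fin k} {r : V → Fin k} {x : V → ℝ}

theorem classWeight_nonneg (hx : ∀ v, 0 ≤ x v) (i : Fin k) : 0 ≤ classWeight r x i :=
  Finset.sum_nonneg fun v _ => by split_ifs; exacts [hx v, le_rfl]

theorem sum_classWeight : ∑ i, classWeight r x i = ∑ v, x v := by
  simp only [classWeight]
  rw [Finset.sum_comm]
  simp

open Classical in
/-- The tuples inside the class `i` are counted by restricting the weights to that class. -/
theorem copies_eq_add (hk : 2 ≤ k) :
    copies ℓ x = transversalCopies ℓ r x +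
      ∑ i, copies ℓ (fun v => if r v = i then x v else 0) + mixedCopies ℓ r x := by
  have h1 : ∀ i, copies ℓ (fun v => if r v = i then x v else 0) =
      ∑ f : Fin k → V with Consistent ℓ f, if ∀ j, r (f j) = i then ∏ n, x (f n) else 0 := by
    intro i
    refine Finset.sum_congr rfl fun f _ => ?_
    by_cases h : ∀ j, r (f j) = i
    · rw [if_pos h]
      exact Finset.prod_congr rfl fun n _ => if_pos (h n)
    · rw [if_neg h]
      push Not at h
      obtain ⟨j, hj⟩ := h
      exact Finset.prod_eq_zero (Finset.mem_univ j) (if_neg hj)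
  simp only [h1]
  rw [Finset.sum_comm, transversalCopies, mixedCopies, copies, ← Finset.filter_filter,
    ← Finset.filter_filter, Finset.sum_filter (s := Finset.univ.filter (Consistent ℓ)),
    Finset.sum_filter (s := Finset.univ.filter (Consistent ℓ)), ← Finset.sum_add_distrib,
    ← Finset.sum_add_distrib]
  refine Finset.sum_congr rfl fun f _ => ?_
  have hk0 : 0 < k := by omega
  have h2 : ∑ i, (if ∀ j, r (f j) = i then ∏ n, x (f n) else 0) =
      if ∃ c, ∀ i, r (f i) = c then ∏ n, x (f n) else 0 := by
    by_cases h : ∃ c, ∀ i, r (f i) = c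
    · rw [if_pos h]
      obtain ⟨c, hc⟩ := h
      rw [Finset.sum_eq_single c, if_pos hc]
      · intro b _ hb
        rw [if_neg]
        intro hb'
        exact hb ((hb' ⟨0, hk0⟩).symm.trans (hc ⟨0, hk0⟩))
      · simp
    · rw [if_neg h]
      refine Finset.sum_eq_zero fun i _ => if_neg fun hi => h ⟨i, hi⟩
  rw [h2]
  by_cases h3 : ∀ i, r (f i) = i
  · have h4 : ¬ ∃ c, ∀ i, r (f i) = c := by
      rintro ⟨c, hc⟩
      have h5 : (⟨0, hk0⟩ : Fin k) = ⟨1, by omega⟩ :=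
        (h3 _).symm.trans ((hc _).trans ((hc _).symm.trans (h3 _)))
      simp at h5
    rw [if_pos h3, if_neg h4, if_neg fun h => h.1 h3, add_zero, add_zero]
  · by_cases h4 : ∃ c, ∀ i, r (f i) = c
    · simp [h3, h4]
    · simp [h3, h4]

theorem mixedCopies_nonneg (hx : ∀ v, 0 ≤ x v) : 0 ≤ mixedCopies ℓ r x :=
  Finset.sum_nonneg fun f _ => prod_apply_nonneg hx f

open Classical in
/-- A tuple that is not transversal has a vertex that does not play its own part. -/
theorem copies_le_transversalCopies_add (hx : ∀ v, 0 ≤ x v) :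
    copies ℓ x ≤ transversalCopies ℓ r x +
      ∑ v, ∑ i ∈ Finset.univ.erase (r v), roleWeight ℓ x i v := by
  have h1 : ∑ v, ∑ i ∈ Finset.univ.erase (r v), roleWeight ℓ x i v =
      ∑ f : Fin k → V with Consistent ℓ f, ∑ i, if r (f i) ≠ i then ∏ n, x (f n) else 0 := by
    have h2 : ∀ v, ∑ i ∈ Finset.univ.erase (r v), roleWeight ℓ x i v =
        ∑ i, if r v ≠ i then roleWeight ℓ x i v else 0 := by
      intro v
      rw [← Finset.sum_filter]
      refine Finset.sum_congr ?_ fun _ _ => rfl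
      ext i
      simp [eq_comm]
    rw [Finset.sum_congr rfl fun v _ => h2 v, Finset.sum_comm]
    rw [Finset.sum_comm (s := Finset.univ.filter (Consistent ℓ))]
    refine Finset.sum_congr rfl fun i _ => ?_
    rw [← Finset.sum_fiberwise (Finset.univ.filter (Consistent ℓ)) (fun f => f i)]
    refine Finset.sum_congr rfl fun v _ => ?_
    rw [roleWeight, ← Finset.filter_filter]
    by_cases hv : r v = i
    · rw [if_neg (not_not.mpr hv)]
      refine (Finset.sum_eq_zero fun f hf => if_neg ?_).symm
      rw [(Finset.mem_filter.mp hf).2]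
      exact not_not.mpr hv
    · rw [if_pos hv]
      refine Finset.sum_congr rfl fun f hf => (if_pos ?_).symm
      rw [(Finset.mem_filter.mp hf).2]
      exact hv
  rw [h1, transversalCopies, ← Finset.filter_filter,
    Finset.sum_filter (s := Finset.univ.filter (Consistent ℓ)), ← Finset.sum_add_distrib]
  refine Finset.sum_le_sum fun f _ => ?_
  have hnn : ∀ i ∈ Finset.univ, 0 ≤ if r (f i) ≠ i then ∏ n, x (f n) else 0 := fun i _ => by
    split_ifs
    · exact prod_apply_nonneg hx f
    · exact le_rfl
  by_cases h : ∀ i, r (f i) = i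
  · rw [if_pos h]
    linarith [Finset.sum_nonneg hnn]
  · rw [if_neg h, zero_add]
    push Not at h
    obtain ⟨i, hi⟩ := h
    refine le_trans ?_ (Finset.single_le_sum hnn (Finset.mem_univ i))
    rw [if_pos hi]

open Classical in
/-- Bad pairs lie in few consistent tuples, and each mixed tuple contains many of them. -/
theorem mixedCopies_le (hk : 3 ≤ k) (hx : ∀ v, 0 ≤ x v) {y : ℝ}
    (hy : ∀ v, 0 < x v → ∀ i, i ≠ r v → partWeight ℓ x i v ≤ y) :
    2 * ((k : ℝ) - 2) * mixedCopies ℓ r x ≤ (y / (k - 2 : ℕ)) ^ (k - 2) * badWeight ℓ r x := by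
  set κ := (y / (k - 2 : ℕ)) ^ (k - 2) with hκ
  have hκ' : ∀ (i : Fin k) (v : V), 0 < x v → i ≠ r v →
      (partWeight ℓ x i v / (k - 2 : ℕ)) ^ (k - 2) ≤ κ := by
    intro i v hv hi
    have := hy v hv i hi
    have h0 := partWeight_nonneg (ℓ := ℓ) hx i v
    rw [hκ]
    gcongr
  -- the weight of the consistent tuples through a given bad pair
  have hpair : ∀ (i j : Fin k) (u v : V), i ≠ j → IsBad ℓ r u v →
      ∑ f : Fin k → V with Consistent ℓ f ∧ f i = u ∧ f j = v, ∏ n, x (f n) ≤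
        if ℓ u v = (i, j) then κ * (x u * x v) else 0 := by
    intro i j u v hij hbad
    split_ifs with hl
    · have h1 := pair_weight_le_pow (ℓ := ℓ) hk hx hij u v
      rcases (hx u).eq_or_lt with h0 | hu
      · rw [← h0] at h1 ⊢
        simpa using h1
      rcases (hx v).eq_or_lt with h0 | hv
      · rw [← h0] at h1 ⊢
        simpa using h1
      by_cases hi : i = r u
      · have hj : j ≠ r v := by
          rintro rfl
          exact hbad.2 (by rw [hl, hi])
        have h2 := pair_weight_le_pow (ℓ := ℓ) hk hx hij.symm v u
        have h3 : (Finset.univ.filter fun f : Fin k → V => Consistent ℓ f ∧ f i = u ∧ f j = v) =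
            Finset.univ.filter fun f : Fin k → V => Consistent ℓ f ∧ f j = v ∧ f i = u := by
          ext f
          simp only [Finset.mem_filter]
          tauto
        rw [h3]
        refine h2.trans ?_
        rw [mul_comm (x v), mul_comm κ]
        exact mul_le_mul_of_nonneg_left (hκ' j v hv hj) (mul_nonneg (hx u) (hx v))
      · refine h1.trans ?_
        rw [mul_comm κ]
        exact mul_le_mul_of_nonneg_left (hκ' i u hu hi) (mul_nonneg (hx u) (hx v))
    · refine le_of_eq (Finset.sum_eq_zero fun f hf => ?_)
      simp only [Finset.mem_filter, Finset.mem_univ, true_and] at hf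
      exact absurd (hf.2.1 ▸ hf.2.2 ▸ hf.1 i j hij) hl
  set Q : Finset (Fin k × Fin k) := Finset.univ.filter fun p => p.1 ≠ p.2 with hQ
  have h1 : 2 * ((k : ℝ) - 2) * mixedCopies ℓ r x ≤ ∑ f : Fin k → V with Consistent ℓ f,
      ∑ p ∈ Q, if IsBad ℓ r (f p.1) (f p.2) then ∏ n, x (f n) else 0 := by
    rw [mixedCopies, ← Finset.filter_filter,
      Finset.sum_filter (s := Finset.univ.filter (Consistent ℓ)), Finset.mul_sum]
    refine Finset.sum_le_sum fun f hf => ?_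
    simp only [Finset.mem_filter, Finset.mem_univ, true_and] at hf
    have hW := prod_apply_nonneg hx f
    split_ifs with h
    · have h2 := two_mul_le_card_misplaced (fun i => r (f i)) h.1 h.2
      rw [← Finset.sum_filter, Finset.sum_const, nsmul_eq_mul]
      refine mul_le_mul_of_nonneg_right ?_ hW
      have h3 : 2 * ((k : ℝ) - 2) = ((2 * (k - 2) : ℕ) : ℝ) := by
        push_cast [Nat.cast_sub (show 2 ≤ k by omega)]; ring
      rw [h3]
      refine Nat.cast_le.mpr (h2.trans (Finset.card_le_card ?_))
      rintro ⟨a, b⟩ hab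
      simp only [hQ, Finset.mem_filter, Finset.mem_univ, true_and] at hab ⊢
      refine ⟨hab.1, hab.2.1, fun h4 => hab.2.2 ?_⟩
      rw [hf a b hab.1, Prod.mk.injEq] at h4
      exact ⟨h4.1.symm, h4.2.symm⟩
    · rw [mul_zero]
      exact Finset.sum_nonneg fun p _ => by split_ifs; exacts [hW, le_rfl]
  refine h1.trans ?_
  rw [Finset.sum_comm]
  have h2 : ∀ p ∈ Q, ∑ f : Fin k → V with Consistent ℓ f,
      (if IsBad ℓ r (f p.1) (f p.2) then ∏ n, x (f n) else 0) ≤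
      ∑ u, ∑ v, if IsBad ℓ r u v then (if ℓ u v = p then κ * (x u * x v) else 0) else 0 := by
    rintro ⟨i, j⟩ hp
    simp only [hQ, Finset.mem_filter, Finset.mem_univ, true_and] at hp
    rw [← Finset.sum_fiberwise (Finset.univ.filter (Consistent ℓ)) (fun f => f i)]
    refine Finset.sum_le_sum fun u _ => ?_
    rw [← Finset.sum_fiberwise _ (fun f : Fin k → V => f j)]
    refine Finset.sum_le_sum fun v _ => ?_
    rw [Finset.filter_filter, Finset.filter_filter]
    by_cases hb : IsBad ℓ r u v
    · rw [if_pos hb]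
      refine le_trans (le_of_eq ?_) (hpair i j u v hp hb)
      refine Finset.sum_congr ?_ fun f hf => ?_
      · ext f
        simp
      · simp only [Finset.mem_filter, Finset.mem_univ, true_and] at hf
        rw [if_pos]
        simpa only [hf.2.1, hf.2.2] using hb
    · rw [if_neg hb]
      refine le_of_eq (Finset.sum_eq_zero fun f hf => ?_)
      simp only [Finset.mem_filter, Finset.mem_univ, true_and] at hf
      rw [if_neg]
      simpa only [hf.2.1, hf.2.2] using hb
  refine (Finset.sum_le_sum h2).trans ?_
  rw [badWeight, Finset.sum_comm, Finset.mul_sum]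
  refine Finset.sum_le_sum fun u _ => ?_
  rw [Finset.sum_comm, Finset.mul_sum]
  refine Finset.sum_le_sum fun v _ => ?_
  by_cases hb : IsBad ℓ r u v
  · simp only [if_pos hb]
    have hκ0 : 0 ≤ κ * (x u * x v) := by
      rcases (hx u).eq_or_lt with h0 | hu
      · simp [← h0]
      obtain ⟨i, hi⟩ : ∃ i : Fin k, i ≠ r u := by
        have : Nontrivial (Fin k) := Fin.nontrivial_iff_two_le.mpr (by omega)
        exact exists_ne (r u)
      have h3 := hκ' i u hu hi
      have h4 := partWeight_nonneg (ℓ := ℓ) hx i u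
      have h5 : 0 ≤ κ := le_trans (by positivity) h3
      exact mul_nonneg h5 (mul_nonneg (hx u) (hx v))
    rw [Finset.sum_ite_eq]
    split_ifs
    · exact le_rfl
    · exact hκ0
  · simp [hb]

theorem badWeight_eq_sum :
    badWeight ℓ r x = ∑ p : Fin k × Fin k with p.1 ≠ p.2, badWeightAt ℓ r x p.1 p.2 := by
  classical
  simp only [badWeight, badWeightAt]
  conv_rhs => rw [Finset.sum_comm]
  refine Finset.sum_congr rfl fun u _ => ?_
  conv_rhs => rw [Finset.sum_comm]
  refine Finset.sum_congr rfl fun v _ => ?_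
  rw [Finset.sum_filter, Finset.sum_eq_single (r u, r v)]
  · by_cases h : r u = r v <;> simp [IsBad, h]
  · rintro ⟨i, j⟩ _ hne
    have : ¬ (r u = i ∧ r v = j ∧ ℓ u v ≠ (i, j)) := by
      rintro ⟨rfl, rfl, -⟩
      exact hne rfl
    simp [this]
  · simp

theorem badWeightAt_comm (hℓ : IsLabeling ℓ) (i j : Fin k) :
    badWeightAt ℓ r x i j = badWeightAt ℓ r x j i := by
  classical
  unfold badWeightAt
  rw [Finset.sum_comm]
  refine Finset.sum_congr rfl fun u _ => Finset.sum_congr rfl fun v _ => ?_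
  have h : ℓ v u = (i, j) ↔ ℓ u v = (j, i) := by
    rw [hℓ u v]
    constructor
    · intro h; simpa using congrArg Prod.swap h
    · intro h; simp [h]
  rw [mul_comm (x v)]
  refine if_congr ?_ rfl rfl
  rw [ne_eq, h]
  tauto

theorem badWeightAt_nonneg (hx : ∀ v, 0 ≤ x v) (i j : Fin k) : 0 ≤ badWeightAt ℓ r x i j :=
  Finset.sum_nonneg fun u _ => Finset.sum_nonneg fun v _ => by
    split_ifs
    exacts [mul_nonneg (hx u) (hx v), le_rfl]

open Classical in
theorem sum_good_pair (i j : Fin k) :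
    ∑ u, ∑ v, (if ℓ u v = (i, j) then 1 else 0) *
      ((if r u = i then x u else 0) * (if r v = j then x v else 0)) =
      classWeight r x i * classWeight r x j - badWeightAt ℓ r x i j := by
  rw [classWeight, classWeight, Finset.sum_mul_sum, badWeightAt, ← Finset.sum_sub_distrib]
  refine Finset.sum_congr rfl fun u _ => ?_
  rw [← Finset.sum_sub_distrib]
  refine Finset.sum_congr rfl fun v _ => ?_
  by_cases h1 : r u = i <;> by_cases h2 : r v = j <;> by_cases h3 : ℓ u v = (i, j) <;>
    simp [h1, h2, h3]

open Classical in
/-- The transversals containing a bad pair between `i` and `j` are not consistent. -/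
theorem transversalCopies_le_pair (hx : ∀ v, 0 ≤ x v) {i j : Fin k} (hij : i ≠ j) :
    transversalCopies ℓ r x ≤
      (classWeight r x i * classWeight r x j - badWeightAt ℓ r x i j) *
        ∏ n ∈ (Finset.univ.erase i).erase j, classWeight r x n := by
  have h := sum_prod_pair hij (fun n v => if r v = n then x v else 0)
    (fun u v => if ℓ u v = (i, j) then 1 else 0)
  rw [sum_good_pair] at h
  simp only [classWeight] at h ⊢
  rw [← h, transversalCopies, Finset.sum_filter]
  refine Finset.sum_le_sum fun f _ => ?_
  have hnn : 0 ≤ ∏ n, (if r (f n) = n then x (f n) else 0) :=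
    Finset.prod_nonneg fun n _ => by split_ifs; exacts [hx _, le_rfl]
  split_ifs with h1 h2 h2
  · rw [one_mul]
    exact le_of_eq (Finset.prod_congr rfl fun n _ => (if_pos (h1.2 n)).symm)
  · exact absurd (h1.1 i j hij) h2
  · rwa [one_mul]
  · rw [zero_mul]

open Classical in
/-- For disjoint pairs of classes, the bad pairs block transversals independently. -/
theorem transversalCopies_le_two_pairs (hx : ∀ v, 0 ≤ x v) {i j l m : Fin k} (hij : i ≠ j)
    (hlm : l ≠ m) (hil : i ≠ l) (him : i ≠ m) (hjl : j ≠ l) (hjm : j ≠ m) :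
    transversalCopies ℓ r x ≤
      (classWeight r x i * classWeight r x j - badWeightAt ℓ r x i j) *
      (classWeight r x l * classWeight r x m - badWeightAt ℓ r x l m) *
        ∏ n ∈ (((Finset.univ.erase i).erase j).erase l).erase m, classWeight r x n := by
  have h := sum_prod_two_pairs hij hlm hil him hjl hjm (fun n v => if r v = n then x v else 0)
    (fun u v => if ℓ u v = (i, j) then 1 else 0) (fun u v => if ℓ u v = (l, m) then 1 else 0)
  rw [sum_good_pair, sum_good_pair] at h
  simp only [classWeight] at h ⊢
  rw [← h, transversalCopies, Finset.sum_filter]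
  refine Finset.sum_le_sum fun f _ => ?_
  have hnn : 0 ≤ ∏ n, (if r (f n) = n then x (f n) else 0) :=
    Finset.prod_nonneg fun n _ => by split_ifs; exacts [hx _, le_rfl]
  by_cases h1 : Consistent ℓ f ∧ ∀ n, r (f n) = n
  · rw [if_pos h1, if_pos (h1.1 i j hij), if_pos (h1.1 l m hlm), one_mul, one_mul]
    exact le_of_eq (Finset.prod_congr rfl fun n _ => (if_pos (h1.2 n)).symm)
  · rw [if_neg h1]
    refine mul_nonneg (mul_nonneg ?_ ?_) hnn <;> split_ifs <;> norm_num

end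

/-! ### The weighted bound for the number of consistent tuples -/

/-- The weight of the non-transversal tuples is small, since each of them has a vertex that does
not play its dominant part. -/
theorem lt_transversalCopies {V : Type*} [Fintype V] {k : ℕ} (hk : 4 ≤ k)
    {ℓ : V → V → Fin k × Fin k} {r : V → Fin k} {x : V → ℝ} (hx : ∀ v, 0 ≤ x v)
    (hx1 : ∑ v, x v = 1) {c y : ℝ} (hc : c ≤ (1 / (k - 1 : ℕ)) ^ (k - 1))
    (hlt : c < copies ℓ x + c * ∑ v, x v ^ k)
    (hdom : ∀ v, 0 < x v → ∑ i ∈ Finset.univ.erase (r v), partWeight ℓ x i v + x v ≤ y) :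
    c - (y / (k - 1 : ℕ)) ^ (k - 1) < transversalCopies ℓ r x := by
  have hk1 : k - 1 ≠ 0 := by omega
  have h1 := copies_le_transversalCopies_add (ℓ := ℓ) (r := r) hx
  have h2 : ∀ v, ∑ i ∈ Finset.univ.erase (r v), roleWeight ℓ x i v + c * x v ^ k ≤
      x v * (y / (k - 1 : ℕ)) ^ (k - 1) := by
    intro v
    set S := ∑ i ∈ Finset.univ.erase (r v), partWeight ℓ x i v with hS
    have hS0 : 0 ≤ S := Finset.sum_nonneg fun i _ => partWeight_nonneg hx i v
    have h3 : ∑ i ∈ Finset.univ.erase (r v), roleWeight ℓ x i v ≤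
        x v * (S / (k - 1 : ℕ)) ^ (k - 1) := by
      calc ∑ i ∈ Finset.univ.erase (r v), roleWeight ℓ x i v
          ≤ ∑ i ∈ Finset.univ.erase (r v), x v * (partWeight ℓ x i v / (k - 1 : ℕ)) ^ (k - 1) :=
            Finset.sum_le_sum fun i _ => roleWeight_le (by omega) hx i v
        _ = x v * ∑ i ∈ Finset.univ.erase (r v), (partWeight ℓ x i v / (k - 1 : ℕ)) ^ (k - 1) := by
            rw [Finset.mul_sum]
        _ ≤ x v * (∑ i ∈ Finset.univ.erase (r v), partWeight ℓ x i v / (k - 1 : ℕ)) ^ (k - 1) :=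
            mul_le_mul_of_nonneg_left (sum_pow_le_sum_pow _ _ (fun i _ =>
              div_nonneg (partWeight_nonneg hx i v) (Nat.cast_nonneg _)) hk1) (hx v)
        _ = _ := by rw [← Finset.sum_div]
    have h4 : c * x v ^ k ≤ x v * (x v / (k - 1 : ℕ)) ^ (k - 1) := by
      have h5 : x v ^ k = x v * x v ^ (k - 1) := by rw [← pow_succ']; congr 1; omega
      have h6 := mul_le_mul_of_nonneg_right hc (pow_nonneg (hx v) k)
      refine h6.trans (le_of_eq ?_)
      rw [h5, div_pow, div_pow, one_pow]
      ring
    rcases (hx v).eq_or_lt with h0 | hv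
    · rw [← h0] at h3 h4 ⊢
      rw [zero_mul] at h3 h4 ⊢
      linarith
    · have h5 : (S / (k - 1 : ℕ)) ^ (k - 1) + (x v / (k - 1 : ℕ)) ^ (k - 1) ≤
          (y / (k - 1 : ℕ)) ^ (k - 1) := by
        have h7 : (0 : ℝ) ≤ (k - 1 : ℕ) := Nat.cast_nonneg _
        refine (pow_add_pow_le (div_nonneg hS0 h7) (div_nonneg (hx v) h7) hk1).trans ?_
        rw [← add_div]
        have := hdom v hv
        have h8 := hx v
        gcongr
      have h6 := mul_le_mul_of_nonneg_left h5 (hx v)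
      linarith
  have h3 := Finset.sum_le_sum fun v (_ : v ∈ Finset.univ) => h2 v
  rw [Finset.sum_add_distrib, ← Finset.mul_sum, ← Finset.sum_mul, hx1, one_mul] at h3
  linarith

/-- Relabeling the bad pairs does not lose tuples, by comparing with the disjoint union of the
hypergraphs on the parts and all transversals. -/
theorem false_of_mixedCopies_le {V : Type*} [Fintype V] {k : ℕ} (hk : 2 ≤ k)
    {ℓ : V → V → Fin k × Fin k} {r : V → Fin k} {x : V → ℝ} (hx : ∀ v, 0 ≤ x v)
    (hx1 : ∑ v, x v = 1)
    (hlt : ((k : ℝ) ^ k - k)⁻¹ < copies ℓ x + ((k : ℝ) ^ k - k)⁻¹ * ∑ v, x v ^ k)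
    (hpart : ∀ i, copies ℓ (fun v => if r v = i then x v else 0) +
      ((k : ℝ) ^ k - k)⁻¹ * ∑ v, (if r v = i then x v else 0) ^ k ≤
        ((k : ℝ) ^ k - k)⁻¹ * (classWeight r x i) ^ k)
    (hmix : mixedCopies ℓ r x ≤ ∏ i, classWeight r x i - transversalCopies ℓ r x) : False := by
  have : NeZero k := ⟨by omega⟩
  have hpos : 0 < (k : ℝ) ^ k - k := sub_pos.mpr (natCast_lt_pow_self hk)
  have h1 := copies_eq_add (ℓ := ℓ) (r := r) (x := x) hk
  have h2 := Finset.sum_le_sum fun i (_ : i ∈ Finset.univ) => hpart i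
  have h3 : ∑ i, ∑ v, (if r v = i then x v else 0) ^ k = ∑ v, x v ^ k := by
    rw [Finset.sum_comm]
    refine Finset.sum_congr rfl fun v _ => ?_
    simp [ite_pow, show k ≠ 0 by omega]
  rw [Finset.sum_add_distrib, ← Finset.mul_sum, ← Finset.mul_sum, h3] at h2
  have h4 := mul_prod_add_sum_pow_le (classWeight r x) (classWeight_nonneg hx)
  rw [sum_classWeight, hx1, one_pow] at h4
  have h5 : ∏ i, classWeight r x i + ((k : ℝ) ^ k - k)⁻¹ * ∑ i, classWeight r x i ^ k ≤
      ((k : ℝ) ^ k - k)⁻¹ := by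
    have h6 := mul_le_mul_of_nonneg_left h4 (inv_nonneg.mpr hpos.le)
    rw [mul_one, mul_add, inv_mul_cancel_left₀ hpos.ne'] at h6
    exact h6
  linarith

theorem prod_eq_mul_mul_prod_erase {k : ℕ} {i j : Fin k} (hij : i ≠ j) (a : Fin k → ℝ) :
    ∏ n, a n = a i * a j * ∏ n ∈ (Finset.univ.erase i).erase j, a n := by
  rw [mul_assoc, Finset.mul_prod_erase (Finset.univ.erase i) a (by simp [hij.symm]),
    Finset.mul_prod_erase _ a (by simp)]

theorem transversal_threshold {k : ℕ} (hk : 5 ≤ k) :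
    19 / 20 * ((k : ℝ) ^ k)⁻¹ ≤
      ((k : ℝ) ^ k - k)⁻¹ - (21 / (20 * (k : ℝ)) / (k - 1 : ℕ)) ^ (k - 1) := by
  obtain ⟨n, rfl⟩ : ∃ n, k = n + 1 := ⟨k - 1, by omega⟩
  have h1 := pow_mul_succ_le_pow_self (n := n) (by omega)
  have hpos : (0 : ℝ) < ((n + 1 : ℕ) : ℝ) ^ (n + 1) - (n + 1 : ℕ) :=
    sub_pos.mpr (natCast_lt_pow_self (by omega))
  have h2 : (((n + 1 : ℕ) : ℝ) ^ (n + 1))⁻¹ ≤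
      (((n + 1 : ℕ) : ℝ) ^ (n + 1) - (n + 1 : ℕ))⁻¹ := by
    apply inv_anti₀ hpos
    linarith
  have hn : (4 : ℝ) ≤ n := by
    have : 4 ≤ n := by omega
    exact_mod_cast this
  have h3 : (21 / (20 * ((n + 1 : ℕ) : ℝ)) / (n + 1 - 1 : ℕ)) ^ (n + 1 - 1) ≤
      1 / 20 * (((n + 1 : ℕ) : ℝ) ^ (n + 1))⁻¹ := by
    simp only [Nat.add_sub_cancel]
    push_cast
    have h4 : 21 / (20 * ((n : ℝ) + 1)) / n = (21 / 20) / ((n + 1) * n) := by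
      field_simp
    rw [h4, div_pow, mul_pow, pow_succ, ← div_eq_mul_inv, div_le_div_iff₀ (by positivity)
      (by positivity)]
    calc ((21 : ℝ) / 20) ^ n * ((n + 1) ^ n * (n + 1))
        = (n + 1) ^ n * (1 / 20) * (20 * (n + 1) * (21 / 20) ^ n) := by ring
      _ ≤ (n + 1) ^ n * (1 / 20) * (n : ℝ) ^ n := by gcongr
      _ = _ := by ring
  linarith

/-- For `k ≥ 5` it suffices that each missing transversal contains at most `k * (k - 1)` ordered
bad pairs. -/
theorem mixedCopies_le_of_five_le {V : Type*} [Fintype V] {k : ℕ} (hk : 5 ≤ k)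
    {ℓ : V → V → Fin k × Fin k} {r : V → Fin k} {x : V → ℝ} (hx : ∀ v, 0 ≤ x v)
    (hx1 : ∑ v, x v = 1)
    (hT : ((k : ℝ) ^ k - k)⁻¹ - (21 / (20 * (k : ℝ)) / (k - 1 : ℕ)) ^ (k - 1) <
      transversalCopies ℓ r x)
    (hmix : 2 * ((k : ℝ) - 2) * mixedCopies ℓ r x ≤
      (21 / (20 * (k : ℝ)) / (k - 2 : ℕ)) ^ (k - 2) * badWeight ℓ r x) :
    mixedCopies ℓ r x ≤ ∏ i, classWeight r x i - transversalCopies ℓ r x := by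
  set T := transversalCopies ℓ r x with hTdef
  set D := ∏ i, classWeight r x i with hD
  have hw := classWeight_nonneg (r := r) hx
  have hk5 : (5 : ℝ) ≤ k := by exact_mod_cast hk
  have hkk : (0 : ℝ) < (k : ℝ) ^ k := by positivity
  have hT1 : 19 / 20 * ((k : ℝ) ^ k)⁻¹ ≤ T := (transversal_threshold hk).trans hT.le
  have hT0 : 0 < T := lt_of_lt_of_le (by positivity) hT1
  have hκ : (21 / (20 * (k : ℝ)) / (k - 2 : ℕ)) ^ (k - 2) * (k * (k - 1)) ≤
      8 * ((k : ℝ) - 2) * T := by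
    refine le_trans ?_ (mul_le_mul_of_nonneg_left hT1 (by linarith))
    obtain ⟨n, rfl⟩ : ∃ n, k = n + 2 := ⟨k - 2, by omega⟩
    have h1 := pow_mul_cube_le_pow_succ (n := n) (by omega)
    have hn : (3 : ℝ) ≤ n := by
      have : 3 ≤ n := by omega
      exact_mod_cast this
    simp only [Nat.add_sub_cancel]
    push_cast
    have h4 : 21 / (20 * ((n : ℝ) + 2)) / n = (21 / 20) / ((n + 2) * n) := by
      field_simp
    have h5 : 8 * ((n : ℝ) + 2 - 2) * (19 / 20 * (((n : ℝ) + 2) ^ (n + 2))⁻¹) =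
        (38 / 5 * n) / (n + 2) ^ (n + 2) := by
      rw [div_eq_mul_inv]; ring
    rw [h4, div_pow, mul_pow, h5, div_mul_eq_mul_div, div_le_div_iff₀ (by positivity)
      (by positivity)]
    calc ((21 : ℝ) / 20) ^ n * ((n + 2) * (n + 2 - 1)) * (n + 2) ^ (n + 2)
        = (n + 2) ^ n * ((21 / 20) ^ n * (n + 2) ^ 3 * (n + 1)) := by ring
      _ ≤ (n + 2) ^ n * (38 / 5 * (n : ℝ) ^ (n + 1)) := by gcongr
      _ = _ := by ring
  -- two classes have product at most `1 / 4`, so the others have product at least `4 * T`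
  have hb : ∀ i j : Fin k, i ≠ j → badWeightAt ℓ r x i j * (4 * T) ≤ D - T := by
    intro i j hij
    have h1 := transversalCopies_le_pair (ℓ := ℓ) (r := r) hx hij
    have h2 := prod_eq_mul_mul_prod_erase hij (classWeight r x)
    rw [← hD] at h2
    set Q := ∏ n ∈ (Finset.univ.erase i).erase j, classWeight r x n with hQ
    have hQ0 : 0 ≤ Q := Finset.prod_nonneg fun n _ => hw n
    have hb0 := badWeightAt_nonneg (ℓ := ℓ) (r := r) hx i j
    have h3 : classWeight r x i + classWeight r x j ≤ 1 := by
      rw [← hx1, ← sum_classWeight (r := r), ← Finset.add_sum_erase _ _ (Finset.mem_univ i),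
        ← Finset.add_sum_erase (Finset.univ.erase i) _ (Finset.mem_erase.mpr
          ⟨hij.symm, Finset.mem_univ j⟩), ← add_assoc]
      exact le_add_of_nonneg_right (Finset.sum_nonneg fun n _ => hw n)
    have h4 : classWeight r x i * classWeight r x j ≤ 1 / 4 := by
      nlinarith [sq_nonneg (classWeight r x i - classWeight r x j), hw i, hw j]
    have h5 : 4 * T ≤ Q := by
      have h6 : T ≤ D := by
        have := mul_nonneg hb0 hQ0
        nlinarith
      have h7 := mul_le_mul_of_nonneg_right h4 hQ0
      linarith
    have h6 := mul_le_mul_of_nonneg_left h5 hb0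
    nlinarith
  have hbad : badWeight ℓ r x * (4 * T) ≤ k * (k - 1) * (D - T) := by
    have hcard : ((Finset.univ.filter fun p : Fin k × Fin k => p.1 ≠ p.2).card : ℝ) =
        k * (k - 1) := by
      have h1 : (Finset.univ.filter fun p : Fin k × Fin k => p.1 ≠ p.2) =
          (Finset.univ : Finset (Fin k)).offDiag := by
        ext p; simp [Finset.mem_offDiag]
      rw [h1, Finset.offDiag_card, Finset.card_univ, Fintype.card_fin,
        Nat.cast_sub (Nat.le_mul_self k)]
      push_cast; ring
    rw [badWeight_eq_sum, Finset.sum_mul, ← hcard, ← nsmul_eq_mul, ← Finset.sum_const]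
    refine Finset.sum_le_sum fun p hp => hb p.1 p.2 (Finset.mem_filter.mp hp).2
  have hDT : 0 ≤ D - T := by
    have h1 := hb ⟨0, by omega⟩ ⟨1, by omega⟩ (by simp)
    have h2 := badWeightAt_nonneg (ℓ := ℓ) (r := r) hx ⟨0, by omega⟩ ⟨1, by omega⟩
    have := mul_nonneg h2 (show 0 ≤ 4 * T by linarith)
    linarith
  have hκ0 : (0 : ℝ) ≤ (21 / (20 * (k : ℝ)) / (k - 2 : ℕ)) ^ (k - 2) := by positivity
  have h1 := mul_le_mul_of_nonneg_right hmix (show 0 ≤ 4 * T by linarith)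
  have h2 := mul_le_mul_of_nonneg_left hbad hκ0
  have h3 := mul_le_mul_of_nonneg_right hκ hDT
  have h4 : 8 * ((k : ℝ) - 2) * T * mixedCopies ℓ r x ≤ 8 * ((k : ℝ) - 2) * T * (D - T) := by
    linarith
  exact le_of_mul_le_mul_left h4 (by
    have : (0 : ℝ) < (k : ℝ) - 2 := by linarith
    positivity)

/-- Two disjoint pairs of parts, `p = w i * w j` and `q = w l * w m` for `k = 4`: the bad pairs
between `i` and `j` and those between `l` and `m` block transversals almost independently. The
constant `0.02584` exceeds `3 / 2 * (21 / 160) ^ 2`, which accounts for the three ways of splitting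
the four classes into pairs. -/
theorem bad_add_bad_le {s p q b b' T : ℝ} (hp : p ≤ s ^ 2 / 4) (hq : q ≤ (1 - s) ^ 2 / 4)
    (hs0 : 0 ≤ s) (hs1 : s ≤ 1) (hp0 : 0 ≤ p) (hq0 : 0 ≤ q) (hb : 0 ≤ b) (hb' : 0 ≤ b')
    (hT : 329 / 100000 ≤ T) (h : T ≤ (p - b) * (q - b')) (h1 : T ≤ (p - b) * q)
    (h2 : T ≤ p * (q - b')) : 2584 / 100000 * (b + b') ≤ p * q - T := by
  have hpq : p * q ≤ (s * (1 - s)) ^ 2 / 16 := by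
    calc p * q ≤ (s ^ 2 / 4) * ((1 - s) ^ 2 / 4) := mul_le_mul hp hq hq0 (by positivity)
      _ = _ := by ring
  have hTpq : T ≤ p * q := h1.trans (mul_le_mul_of_nonneg_right (by linarith) hq0)
  -- neither product is small, since the other one would have to be large
  have hsmall : ∀ s p q : ℝ, p ≤ s ^ 2 / 4 → 0 ≤ s → s ≤ 1 → 0 ≤ p → T ≤ p * q →
      p * q ≤ (s * (1 - s)) ^ 2 / 16 → 31 / 1000 ≤ q := by
    intro s p q hp hs0 hs1 hp0 hTpq hpq
    by_contra! hlt
    have h3 : p * q ≤ p * (31 / 1000) := mul_le_mul_of_nonneg_left hlt.le hp0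
    have h4 : 65 / 100 ≤ s := by
      by_contra! h
      have : s ^ 2 < (65 / 100) ^ 2 := pow_lt_pow_left₀ h hs0 (by norm_num)
      linarith
    have h5 : s * (1 - s) ≤ 2275 / 10000 := by nlinarith only [h4]
    have h6 : 0 ≤ s * (1 - s) := mul_nonneg hs0 (by linarith)
    have h7 : (s * (1 - s)) ^ 2 ≤ (2275 / 10000) ^ 2 := pow_le_pow_left₀ h6 h5 2
    linarith
  have hq1 := hsmall s p q hp hs0 hs1 hp0 hTpq hpq
  have hp1 := hsmall (1 - s) q p hq (by linarith) (by linarith) hq0 (by linarith) (by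
    rw [mul_comm q p, sub_sub_cancel, mul_comm (1 - s)]; exact hpq)
  have hD : p * q ≤ 1 / 256 := by
    have h3 : s * (1 - s) ≤ 1 / 4 := by nlinarith only [sq_nonneg (s - 1 / 2)]
    have h4 : 0 ≤ s * (1 - s) := mul_nonneg hs0 (by linarith)
    have h7 : (s * (1 - s)) ^ 2 ≤ (1 / 4) ^ 2 := pow_le_pow_left₀ h4 h3 2
    linarith
  have hZ : b * q + b' * p - b * b' ≤ p * q - T := by linarith
  have hbM : b * q ≤ p * q - T := by linarith
  have hbM' : b' * p ≤ p * q - T := by linarith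
  have hM16 : p * q - T ≤ 16 / 100 * (p * q) := by linarith
  have hD0 : 0 < p * q := by linarith
  generalize p * q - T = M at *
  have h3 : b * b' * (p * q) ≤ 8 / 100 * (b * q + b' * p) * (p * q) := by
    have h4 : (b * q) * (b' * p) ≤ M * (b' * p) :=
      mul_le_mul_of_nonneg_right hbM (mul_nonneg hb' hp0)
    have h5 : (b * q) * (b' * p) ≤ (b * q) * M :=
      mul_le_mul_of_nonneg_left hbM' (mul_nonneg hb hq0)
    have h6 : M * (b * q + b' * p) ≤ 16 / 100 * (p * q) * (b * q + b' * p) :=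
      mul_le_mul_of_nonneg_right hM16 (by positivity)
    linarith
  have h4 : b * b' ≤ 8 / 100 * (b * q + b' * p) := le_of_mul_le_mul_right h3 hD0
  have h5 : b * (31 / 1000) ≤ b * q := mul_le_mul_of_nonneg_left hq1 hb
  have h6 : b' * (31 / 1000) ≤ b' * p := mul_le_mul_of_nonneg_left hp1 hb'
  linarith

/-- For `k = 4` the trivial count of the bad pairs in a missing transversal is too weak; it is
replaced by averaging over the three perfect matchings of the four classes. -/
theorem mixedCopies_le_of_four {V : Type*} [Fintype V]
    {ℓ : V → V → Fin 4 × Fin 4} (hℓ : IsLabeling ℓ) {r : V → Fin 4} {x : V → ℝ}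
    (hx : ∀ v, 0 ≤ x v) (hx1 : ∑ v, x v = 1)
    (hT : 329 / 100000 ≤ transversalCopies ℓ r x)
    (hmix : 4 * mixedCopies ℓ r x ≤ (21 / 160) ^ 2 * badWeight ℓ r x) :
    mixedCopies ℓ r x ≤ ∏ i, classWeight r x i - transversalCopies ℓ r x := by
  have hw := classWeight_nonneg (r := r) hx
  have hsum : classWeight r x 0 + classWeight r x 1 + classWeight r x 2 +
      classWeight r x 3 = 1 := by
    rw [← hx1, ← sum_classWeight (r := r), Fin.sum_univ_four]
  have hprod := Fin.prod_univ_four (classWeight r x)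
  have key : ∀ i j l m : Fin 4, i ≠ j → l ≠ m → i ≠ l → i ≠ m → j ≠ l → j ≠ m →
      2584 / 100000 * (badWeightAt ℓ r x i j + badWeightAt ℓ r x l m) ≤
        ∏ i, classWeight r x i - transversalCopies ℓ r x := by
    intro i j l m hij hlm hil him hjl hjm
    have e1 : ((((Finset.univ : Finset (Fin 4)).erase i).erase j).erase l).erase m = ∅ := by
      rw [← Finset.card_eq_zero, Finset.card_erase_of_mem (by simp [hlm.symm, him.symm, hjm.symm]),
        Finset.card_erase_of_mem (by simp [hil.symm, hjl.symm]),
        Finset.card_erase_of_mem (by simp [hij.symm]), Finset.card_erase_of_mem (by simp)]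
      simp
    have e2 : ∀ a : Fin 4 → ℝ, ∏ n ∈ (Finset.univ.erase i).erase j, a n = a l * a m := by
      intro a
      rw [← Finset.mul_prod_erase _ a (show l ∈ (Finset.univ.erase i).erase j by
        simp [hil.symm, hjl.symm]), ← Finset.mul_prod_erase _ a
        (show m ∈ ((Finset.univ.erase i).erase j).erase l by
          simp [hlm.symm, him.symm, hjm.symm]), e1]
      simp
    have e3 : ∀ a : Fin 4 → ℝ, ∏ n ∈ (Finset.univ.erase l).erase m, a n = a i * a j := by
      intro a
      have h : (((Finset.univ : Finset (Fin 4)).erase l).erase m).erase i =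
          (((Finset.univ : Finset (Fin 4)).erase i).erase l).erase m := by
        ext n; simp only [Finset.mem_erase, Finset.mem_univ, and_true]; tauto
      have h' : ((((Finset.univ : Finset (Fin 4)).erase i).erase l).erase m).erase j = ∅ := by
        rw [← e1]
        ext n; simp only [Finset.mem_erase, Finset.mem_univ, and_true]; tauto
      rw [← Finset.mul_prod_erase _ a (show i ∈ (Finset.univ.erase l).erase m by
        simp [hil, him]), h, ← Finset.mul_prod_erase _ a
        (show j ∈ ((Finset.univ.erase i).erase l).erase m by
          simp [hij.symm, hjl, hjm]), h']
      simp
    have t1 := transversalCopies_le_two_pairs (ℓ := ℓ) (r := r) hx hij hlm hil him hjl hjm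
    have t2 := transversalCopies_le_pair (ℓ := ℓ) (r := r) hx hij
    have t3 := transversalCopies_le_pair (ℓ := ℓ) (r := r) hx hlm
    have t4 := prod_eq_mul_mul_prod_erase hij (classWeight r x)
    rw [e1, Finset.prod_empty, mul_one] at t1
    rw [e2] at t2 t4
    rw [e3, mul_comm] at t3
    have hs : classWeight r x l + classWeight r x m =
        1 - (classWeight r x i + classWeight r x j) := by
      have h1 := sum_classWeight (r := r) (x := x)
      rw [hx1, ← Finset.add_sum_erase _ _ (Finset.mem_univ i), ← Finset.add_sum_erase
        (Finset.univ.erase i) _ (show j ∈ _ by simp [hij.symm]), ← Finset.add_sum_erase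
        ((Finset.univ.erase i).erase j) _ (show l ∈ _ by simp [hil.symm, hjl.symm]),
        ← Finset.add_sum_erase (((Finset.univ.erase i).erase j).erase l) _
        (show m ∈ _ by simp [hlm.symm, him.symm, hjm.symm]), e1, Finset.sum_empty] at h1
      linarith
    rw [t4]
    refine bad_add_bad_le (s := classWeight r x i + classWeight r x j) ?_ ?_
      (add_nonneg (hw i) (hw j)) ?_ (mul_nonneg (hw i) (hw j)) (mul_nonneg (hw l) (hw m))
      (badWeightAt_nonneg hx i j) (badWeightAt_nonneg hx l m) hT t1 t2 t3
    · nlinarith [sq_nonneg (classWeight r x i - classWeight r x j)]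
    · rw [← hs]
      nlinarith [sq_nonneg (classWeight r x l - classWeight r x m)]
    · linarith [hw l, hw m]
  have k1 := key 0 1 2 3 (by decide) (by decide) (by decide) (by decide) (by decide) (by decide)
  have k2 := key 0 2 1 3 (by decide) (by decide) (by decide) (by decide) (by decide) (by decide)
  have k3 := key 0 3 1 2 (by decide) (by decide) (by decide) (by decide) (by decide) (by decide)
  have hbad : badWeight ℓ r x = 2 * (badWeightAt ℓ r x 0 1 + badWeightAt ℓ r x 2 3 +
      (badWeightAt ℓ r x 0 2 + badWeightAt ℓ r x 1 3) +
      (badWeightAt ℓ r x 0 3 + badWeightAt ℓ r x 1 2)) := by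
    rw [badWeight_eq_sum, Finset.sum_filter, Fintype.sum_prod_type]
    simp only [Fin.sum_univ_four]
    rw [badWeightAt_comm hℓ 1 0, badWeightAt_comm hℓ 2 0, badWeightAt_comm hℓ 3 0,
      badWeightAt_comm hℓ 2 1, badWeightAt_comm hℓ 3 1, badWeightAt_comm hℓ 3 2]
    norm_num [Fin.ext_iff]
    ring
  rw [hbad] at hmix
  have b1 := badWeightAt_nonneg (ℓ := ℓ) (r := r) hx
  norm_num at hmix
  linarith [b1 0 1, b1 2 3, b1 0 2, b1 1 3, b1 0 3, b1 1 2]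

/-- The iterated balanced complete `k`-partite hypergraph maximizes the number of consistent
tuples. -/
theorem copies_add_le {V : Type*} [Fintype V] {k : ℕ} (hk : 4 ≤ k)
    {ℓ : V → V → Fin k × Fin k} (hℓ : IsLabeling ℓ) (U : Finset V) (x : V → ℝ)
    (hx : ∀ v, 0 ≤ x v) (hU : ∀ v ∉ U, x v = 0) :
    copies ℓ x + ((k : ℝ) ^ k - k)⁻¹ * ∑ v, x v ^ k ≤
      ((k : ℝ) ^ k - k)⁻¹ * (∑ v, x v) ^ k := by
  classical
  induction U using Finset.strongInduction generalizing x with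
  | H U ih =>
    by_contra! hviol
    obtain ⟨x, hx, hU, hpos, hx1, hlt, hdeg⟩ := exists_extremal (by omega) hℓ U ih hx hU hviol
    have hk4 : (4 : ℝ) ≤ k := by exact_mod_cast hk
    have hcpos : 0 < (k : ℝ) ^ k - k := sub_pos.mpr (natCast_lt_pow_self (by omega))
    have hxU : ∀ v, 0 < x v → v ∈ U := fun v hv => by
      by_contra h
      exact hv.ne' (hU v h)
    have hdom : ∀ v, ∃ i, 0 < x v → 1 - 21 / (20 * (k : ℝ)) ≤ partWeight ℓ x i v := by
      intro v
      by_cases hv : 0 < x v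
      · obtain ⟨n, rfl⟩ : ∃ n, k = n + 1 := ⟨k - 1, by omega⟩
        have hn0 : (0 : ℝ) < (n : ℝ) + 1 := by positivity
        have h1 := hdeg v (hxU v hv)
        have h2 := Finset.sum_le_sum fun i (_ : i ∈ Finset.univ) =>
          roleWeight_le (ℓ := ℓ) (by omega) hx i v
        rw [← Finset.mul_sum] at h2
        have h3 := h1.trans_le h2
        simp only [Nat.add_sub_cancel] at h3
        rw [mul_comm _ (x v), mul_assoc] at h3
        have h4 := lt_of_mul_lt_mul_left h3 hv.le
        obtain ⟨i, hi⟩ := exists_dominant (by omega) (fun i => partWeight ℓ x i v)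
          (fun i => partWeight_nonneg hx i v) hv.le
          (hx1 ▸ sum_partWeight_add_le hℓ hx v) (by
            refine lt_of_le_of_lt (le_of_eq ?_) h4
            push_cast at hcpos ⊢
            have h5 : ((n : ℝ) + 1) ^ (n + 1) - (n + 1) = (n + 1) * ((n + 1) ^ n - 1) := by ring
            rw [h5] at hcpos ⊢
            have h6 : 0 < ((n : ℝ) + 1) ^ n - 1 := pos_of_mul_pos_right hcpos hn0.le
            field_simp)
        refine ⟨i, fun _ => ?_⟩
        push_cast
        exact hi
      · exact ⟨⟨0, by omega⟩, fun h => absurd h hv⟩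
    choose r hr using hdom
    have hrest : ∀ v, 0 < x v → ∑ i ∈ Finset.univ.erase (r v), partWeight ℓ x i v + x v ≤
        21 / (20 * (k : ℝ)) := by
      intro v hv
      have h1 := sum_partWeight_add_le (x := x) hℓ hx v
      rw [hx1, ← Finset.add_sum_erase _ _ (Finset.mem_univ (r v))] at h1
      linarith [hr v hv]
    have hc : ((k : ℝ) ^ k - k)⁻¹ ≤ (1 / (k - 1 : ℕ)) ^ (k - 1) := by
      obtain ⟨n, rfl⟩ : ∃ n, k = n + 1 := ⟨k - 1, by omega⟩
      have hn : (3 : ℝ) ≤ n := by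
        have : 3 ≤ n := by omega
        exact_mod_cast this
      simp only [Nat.add_sub_cancel]
      rw [div_pow, one_pow, ← one_div]
      refine one_div_le_one_div_of_le (by positivity) ?_
      push_cast
      have h1 : (n : ℝ) ^ n ≤ (n + 1) ^ n := by gcongr; linarith
      have h2 : (n : ℝ) + 1 ≤ (n + 1) ^ n := le_self_pow₀ (by linarith) (by omega)
      rw [pow_succ]
      nlinarith
    have hT := lt_transversalCopies hk hx hx1 hc hlt hrest
    have hy : ∀ v, 0 < x v → ∀ i, i ≠ r v → partWeight ℓ x i v ≤ 21 / (20 * (k : ℝ)) := by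
      intro v hv i hi
      have h1 := Finset.single_le_sum (f := fun i => partWeight ℓ x i v)
        (fun j _ => partWeight_nonneg hx j v)
        (Finset.mem_erase.mpr ⟨hi, Finset.mem_univ i⟩)
      have h2 := hrest v hv
      linarith
    have hmix := mixedCopies_le (ℓ := ℓ) (r := r) (by omega) hx hy
    have hfin : mixedCopies ℓ r x ≤ ∏ i, classWeight r x i - transversalCopies ℓ r x ∧
        0 < transversalCopies ℓ r x := by
      rcases hk.eq_or_lt with rfl | hk5
      · norm_num at hT hmix
        -- `1 / 252 - (7 / 80) ^ 3 > 0.00329`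
        have hT' : 329 / 100000 ≤ transversalCopies ℓ r x := by linarith
        refine ⟨mixedCopies_le_of_four hℓ hx hx1 hT' ?_, by linarith⟩
        norm_num
        linarith
      · refine ⟨mixedCopies_le_of_five_le hk5 hx hx1 hT hmix, lt_of_le_of_lt ?_ hT⟩
        exact le_trans (by positivity) (transversal_threshold hk5)
    have hw : ∀ i, 0 < classWeight r x i := by
      intro i
      refine (classWeight_nonneg hx i).lt_of_ne fun h0 => ?_
      have h1 : ∏ i, classWeight r x i = 0 := Finset.prod_eq_zero (Finset.mem_univ i) h0.symm
      have h2 := mixedCopies_nonneg (ℓ := ℓ) (r := r) hx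
      linarith [hfin.1, hfin.2]
    refine false_of_mixedCopies_le (by omega) hx hx1 hlt (fun i => ?_) hfin.1
    refine ih (U.filter fun v => r v = i) ?_ _ (fun v => ?_) (fun v hv => ?_)
    · refine Finset.filter_ssubset.mpr ?_
      obtain ⟨j, hj⟩ : ∃ j : Fin k, j ≠ i := by
        have : Nontrivial (Fin k) := Fin.nontrivial_iff_two_le.mpr (by omega)
        exact exists_ne i
      by_contra! hall
      refine (hw j).ne' (Finset.sum_eq_zero fun v _ => ?_)
      split_ifs with h
      · exact hU v fun hvU => hj (h.symm.trans (hall v hvU))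
      · rfl
    · split_ifs
      exacts [hx v, le_rfl]
    · split_ifs with h
      · exact hU v fun hvU => hv (Finset.mem_filter.mpr ⟨hvU, h⟩)
      · rfl

/-! ### Random labelings and the exponential lower bound -/

open Classical in
/-- For `s = k ^ m`, the images of the consistent tuples form a hypergraph in which `s` vertices
span at most `g k s` edges. -/
theorem card_images_le_g {V : Type*} [Fintype V] {k : ℕ} (hk : 4 ≤ k)
    {ℓ : V → V → Fin k × Fin k} (hℓ : IsLabeling ℓ) (m : ℕ) (S : Finset V) (hS : S.card = k ^ m) :
    ((S.powersetCard k).filter fun e =>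
      ∃ f : Fin k → V, Consistent ℓ f ∧ Finset.univ.image f = e).card ≤ g k (k ^ m) := by
  have hpos : 0 < (k : ℝ) ^ k - k := sub_pos.mpr (natCast_lt_pow_self (by omega))
  set F : Finset (Fin k → V) :=
    Finset.univ.filter fun f => Consistent ℓ f ∧ ∀ i, f i ∈ S with hF
  have h1 : ((S.powersetCard k).filter fun e =>
      ∃ f : Fin k → V, Consistent ℓ f ∧ Finset.univ.image f = e) ⊆
      F.image fun f => Finset.univ.image f := by
    intro e he
    simp only [Finset.mem_filter, Finset.mem_powersetCard] at he
    obtain ⟨⟨heS, -⟩, f, hf, rfl⟩ := he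
    refine Finset.mem_image.mpr ⟨f, ?_, rfl⟩
    simp only [hF, Finset.mem_filter, Finset.mem_univ, true_and]
    exact ⟨hf, fun i => heS (Finset.mem_image_of_mem f (Finset.mem_univ i))⟩
  have h2 : ((S.powersetCard k).filter fun e =>
      ∃ f : Fin k → V, Consistent ℓ f ∧ Finset.univ.image f = e).card ≤ F.card :=
    (Finset.card_le_card h1).trans Finset.card_image_le
  refine h2.trans ?_
  have h3 := copies_add_le hk hℓ Finset.univ (fun v => if v ∈ S then 1 else 0)
    (fun v => by split_ifs <;> norm_num) (by simp)
  have h4 : copies ℓ (fun v => if v ∈ S then (1 : ℝ) else 0) = F.card := by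
    rw [copies, hF, ← Finset.filter_filter, Finset.card_filter, Nat.cast_sum]
    refine Finset.sum_congr rfl fun f _ => ?_
    simp only [Finset.prod_ite_zero, Finset.prod_const_one, Finset.mem_univ, true_imp_iff]
    push_cast
    rfl
  have h5 : ∑ v, (if v ∈ S then (1 : ℝ) else 0) = (k : ℝ) ^ m := by
    simp [hS]
  have h6 : ∑ v, (if v ∈ S then (1 : ℝ) else 0) ^ k = (k : ℝ) ^ m := by
    have : ∀ v, (if v ∈ S then (1 : ℝ) else 0) ^ k = if v ∈ S then (1 : ℝ) else 0 := by
      intro v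
      split_ifs
      · simp
      · simp [show k ≠ 0 by omega]
    rw [Finset.sum_congr rfl fun v _ => this v, h5]
  rw [h4, h5, h6] at h3
  have h7 := g_pow_mul (k := k) (by omega) m
  have h8 := mul_le_mul_of_nonneg_right h3 hpos.le
  rw [add_mul, mul_right_comm, mul_right_comm _ _ ((k : ℝ) ^ k - k), inv_mul_cancel₀ hpos.ne',
    one_mul, one_mul] at h8
  have h9 : (F.card : ℝ) * ((k : ℝ) ^ k - k) ≤ g k (k ^ m) * ((k : ℝ) ^ k - k) := by
    rw [h7]; linarith
  exact_mod_cast le_of_mul_le_mul_right h9 hpos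

/-- Among the maps `E → Q`, those that miss the pattern `τ t` on every one of the disjoint blocks
`B t` are rare: on each block, the patterns are equally frequent. -/
theorem card_avoid_le {E Q ι : Type*} [Fintype E] [DecidableEq E] [Fintype Q] [DecidableEq Q]
    [DecidableEq ι] (B : ι → Finset E) (τ : ι → E → Q) {b : ℕ}
    (hb : ∀ t, (B t).card ≤ b) (hQ : 1 ≤ Fintype.card Q) (T : Finset ι)
    (hdisj : ∀ s ∈ T, ∀ t ∈ T, s ≠ t → Disjoint (B s) (B t)) :
    ((Finset.univ.filter fun c : E → Q => ∀ t ∈ T, ∃ e ∈ B t, c e ≠ τ t e).card : ℝ) ≤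
      Fintype.card (E → Q) * (1 - ((Fintype.card Q : ℝ) ^ b)⁻¹) ^ T.card := by
  have hQ1 : (1 : ℝ) ≤ Fintype.card Q := by exact_mod_cast hQ
  have hq : (0 : ℝ) < (Fintype.card Q : ℝ) ^ b := by positivity
  have hq1 : 0 ≤ 1 - ((Fintype.card Q : ℝ) ^ b)⁻¹ := by
    rw [sub_nonneg]
    exact inv_le_one_of_one_le₀ (one_le_pow₀ hQ1)
  induction T using Finset.induction_on with
  | empty => simp
  | insert t T ht ih =>
    have ih := ih fun s hs t' ht' => hdisj s (Finset.mem_insert_of_mem hs) t'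
      (Finset.mem_insert_of_mem ht')
    set A : Finset (E → Q) := Finset.univ.filter fun c => ∀ t ∈ T, ∃ e ∈ B t, c e ≠ τ t e with hA
    set H : Finset (E → Q) := A.filter fun c => ∀ e ∈ B t, c e = τ t e with hH
    have h1 : (Finset.univ.filter fun c : E → Q => ∀ s ∈ insert t T, ∃ e ∈ B s, c e ≠ τ s e) =
        A \ H := by
      ext c
      simp only [hA, hH, Finset.mem_filter, Finset.mem_univ, true_and, Finset.mem_insert,
        forall_eq_or_imp, Finset.mem_sdiff, not_and, not_forall]
      constructor
      · rintro ⟨⟨e, he, hne⟩, h⟩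
        exact ⟨h, fun _ => ⟨e, he, hne⟩⟩
      · rintro ⟨h, h'⟩
        obtain ⟨e, he, hne⟩ := h' h
        exact ⟨⟨e, he, hne⟩, h⟩
    have hHA : H ⊆ A := Finset.filter_subset _ _
    have h2 : A.card ≤ H.card * Fintype.card Q ^ b := by
      have h3 : A.card ≤ (H ×ˢ (Finset.univ : Finset (B t → Q))).card := by
        refine Finset.card_le_card_of_injOn
          (fun c => (fun e => if e ∈ B t then τ t e else c e, fun e => c e)) ?_ ?_
        · intro c hc
          simp only [hA, Finset.coe_filter, Finset.mem_univ, true_and, Set.mem_ofPred_eq] at hc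
          simp only [Finset.coe_product, Finset.coe_univ, Set.mem_prod, Set.mem_univ, and_true,
            hH, hA, Finset.mem_coe, Finset.mem_filter, Finset.mem_univ, true_and]
          refine ⟨fun s hs => ?_, fun e he => if_pos he⟩
          obtain ⟨e, he, hne⟩ := hc s hs
          refine ⟨e, he, ?_⟩
          have hst : s ≠ t := fun h => ht (h ▸ hs)
          have hd := hdisj s (Finset.mem_insert_of_mem hs) t (Finset.mem_insert_self t T) hst
          rwa [if_neg (Finset.disjoint_left.mp hd he)]
        · intro c _ d _ hcd
          simp only [Prod.mk.injEq] at hcd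
          funext e
          by_cases he : e ∈ B t
          · exact congrFun hcd.2 ⟨e, he⟩
          · simpa [he] using congrFun hcd.1 e
      rw [Finset.card_product, Finset.card_univ, Fintype.card_fun, Fintype.card_coe] at h3
      exact h3.trans (Nat.mul_le_mul_left _ (Nat.pow_le_pow_right hQ (hb t)))
    have h3 : (A.card : ℝ) ≤ H.card * (Fintype.card Q : ℝ) ^ b := by exact_mod_cast h2
    rw [h1, Finset.card_sdiff_of_subset hHA, Nat.cast_sub (Finset.card_le_card hHA),
      Finset.card_insert_of_notMem ht, pow_succ, ← mul_assoc]
    refine le_trans ?_ (mul_le_mul_of_nonneg_right ih hq1)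
    rw [mul_sub, mul_one]
    have h4 : (A.card : ℝ) * ((Fintype.card Q : ℝ) ^ b)⁻¹ ≤ H.card := by
      rw [← div_eq_mul_inv, div_le_iff₀ hq]; exact h3
    linarith

/-- In any `n` ordered vertices there are `x ^ 2` increasing `k`-tuples, indexed by the lines of
slope and intercept less than `x`, any two of which have at most one vertex in common. -/
theorem exists_disjoint_tuples {N k n x : ℕ} (hx : k * ((k + 1) * x) ≤ n)
    (A : Finset (Fin N)) (hA : A.card = n) :
    ∃ F : Fin x × Fin x → Fin k → Fin N, (∀ t, StrictMono (F t)) ∧ (∀ t i, F t i ∈ A) ∧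
      ∀ s t i j i' j', i < j → i' < j' → F s i = F t i' → F s j = F t j' → s = t := by
  have hlt : ∀ (a b : Fin x) (i : Fin k), (a : ℕ) + b * i < (k + 1) * x := by
    intro a b i
    have h1 : (b : ℕ) * i ≤ x * k := Nat.mul_le_mul b.isLt.le i.isLt.le
    have h2 := a.isLt
    nlinarith
  have hidx : ∀ (a b : Fin x) (i : Fin k), (i : ℕ) * ((k + 1) * x) + (a + b * i) < n := by
    intro a b i
    have h1 := hlt a b i
    have h2 : ((i : ℕ) + 1) * ((k + 1) * x) ≤ k * ((k + 1) * x) := Nat.mul_le_mul_right _ i.isLt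
    rw [add_mul, one_mul] at h2
    omega
  refine ⟨fun t i => A.orderEmbOfFin hA ⟨i * ((k + 1) * x) + (t.1 + t.2 * i), hidx t.1 t.2 i⟩,
    fun t i j hij => ?_, fun t i => A.orderEmbOfFin_mem hA _, ?_⟩
  · refine (A.orderEmbOfFin hA).strictMono ?_
    rw [Fin.mk_lt_mk]
    have hij' : (i : ℕ) + 1 ≤ j := hij
    have h1 := hlt t.1 t.2 i
    have h2 : ((i : ℕ) + 1) * ((k + 1) * x) ≤ j * ((k + 1) * x) := Nat.mul_le_mul_right _ hij'
    rw [add_mul, one_mul] at h2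
    omega
  · rintro ⟨a, b⟩ ⟨a', b'⟩ i j i' j' hij hij' h1 h2
    simp only [EmbeddingLike.apply_eq_iff_eq, Fin.mk.injEq] at h1 h2
    have hdiv : ∀ (a b : Fin x) (i : Fin k),
        ((i : ℕ) * ((k + 1) * x) + (a + b * i)) / ((k + 1) * x) = i := by
      intro a b i
      have h := hlt a b i
      rw [mul_comm, Nat.mul_add_div (by omega), Nat.div_eq_of_lt h, add_zero]
    have hi : (i : ℕ) = i' := by rw [← hdiv a b i, ← hdiv a' b' i', h1]
    have hj : (j : ℕ) = j' := by rw [← hdiv a b j, ← hdiv a' b' j', h2]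
    rw [← hi] at h1
    rw [← hj] at h2
    have h3 : (a : ℕ) + b * i = a' + b' * i := Nat.add_left_cancel h1
    have h4 : (a : ℕ) + b * j = a' + b' * j := Nat.add_left_cancel h2
    have h5 : ((b : ℤ) - b') * ((j : ℤ) - i) = 0 := by
      have h3' : (a : ℤ) + b * i = a' + b' * i := by exact_mod_cast h3
      have h4' : (a : ℤ) + b * j = a' + b' * j := by exact_mod_cast h4
      linarith
    have h6 : (j : ℤ) - i ≠ 0 := by
      have : (i : ℕ) < j := hij
      omega
    have h7 : (b : ℤ) = b' := by
      have := (mul_eq_zero.mp h5).resolve_right h6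
      linarith
    have h8 : (b : ℕ) = b' := by exact_mod_cast h7
    have h9 : (a : ℕ) = a' := by rw [h8] at h3; exact Nat.add_right_cancel h3
    rw [Fin.ext h8, Fin.ext h9]

/-- The probabilistic construction: a random map makes some increasing tuple of each `n`-set
consistent. -/
theorem exists_map_hitting {N k n x : ℕ} (hk : 1 ≤ k) (hx : k * ((k + 1) * x) ≤ n)
    (hN : (N : ℝ) ^ n * (1 - (((k * k : ℕ) : ℝ) ^ (k * k))⁻¹) ^ (x * x) < 1) :
    ∃ c : Fin N × Fin N → Fin k × Fin k, ∀ A : Finset (Fin N), A.card = n →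
      ∃ f : Fin k → Fin N, StrictMono f ∧ (∀ i, f i ∈ A) ∧
        ∀ i j, i < j → c (f i, f j) = (i, j) := by
  classical
  by_contra! hno
  set Bad : Finset (Fin N) → Finset (Fin N × Fin N → Fin k × Fin k) := fun A =>
    Finset.univ.filter fun c => ∀ f : Fin k → Fin N, StrictMono f → (∀ i, f i ∈ A) →
      ∃ i j, i < j ∧ c (f i, f j) ≠ (i, j) with hBad
  set δ : ℝ := 1 - (((k * k : ℕ) : ℝ) ^ (k * k))⁻¹ with hδ
  set Ω : ℝ := ((Fintype.card (Fin N × Fin N → Fin k × Fin k) : ℕ) : ℝ) with hΩ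
  have hΩ0 : 0 < Ω := by
    have : Nonempty (Fin N × Fin N → Fin k × Fin k) := ⟨fun _ => (⟨0, hk⟩, ⟨0, hk⟩)⟩
    rw [hΩ]
    exact_mod_cast Fintype.card_pos
  have hδ0 : 0 ≤ δ := by
    rw [hδ, sub_nonneg]
    refine inv_le_one_of_one_le₀ (one_le_pow₀ ?_)
    exact_mod_cast Nat.mul_pos hk hk
  have hbad : ∀ A : Finset (Fin N), A.card = n → ((Bad A).card : ℝ) ≤ Ω * δ ^ (x * x) := by
    intro A hA
    obtain ⟨F, hmono, hmem, hdis⟩ := exists_disjoint_tuples hx A hA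
    set P : Finset (Fin k × Fin k) := Finset.univ.filter fun p => p.1 < p.2 with hP
    set B : Fin x × Fin x → Finset (Fin N × Fin N) :=
      fun t => P.image fun p => (F t p.1, F t p.2) with hB
    -- the pattern sends `(F t i, F t j)` to `(i, j)`
    set τ : Fin x × Fin x → Fin N × Fin N → Fin k × Fin k := fun t e =>
      (if h : ∃ i, F t i = e.1 then h.choose else ⟨0, hk⟩,
        if h : ∃ i, F t i = e.2 then h.choose else ⟨0, hk⟩) with hτ
    have hτ' : ∀ t i j, τ t (F t i, F t j) = (i, j) := by
      intro t i j
      have h1 : ∃ i', F t i' = F t i := ⟨i, rfl⟩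
      have h2 : ∃ j', F t j' = F t j := ⟨j, rfl⟩
      simp only [hτ, dif_pos h1, dif_pos h2, Prod.mk.injEq]
      exact ⟨(hmono t).injective h1.choose_spec, (hmono t).injective h2.choose_spec⟩
    have hBcard : ∀ t, (B t).card ≤ k * k := by
      intro t
      refine Finset.card_image_le.trans ((Finset.card_filter_le _ _).trans ?_)
      simp
    have h := card_avoid_le B τ hBcard (by simpa using hk) Finset.univ (by
      intro s _ t _ hst
      rw [Finset.disjoint_left]
      rintro e hs ht
      simp only [hB, hP, Finset.mem_image, Finset.mem_filter, Finset.mem_univ, true_and] at hs ht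
      obtain ⟨⟨i, j⟩, hij, rfl⟩ := hs
      obtain ⟨⟨i', j'⟩, hij', heq⟩ := ht
      simp only [Prod.mk.injEq] at heq hij hij'
      exact hst (hdis s t i j i' j' hij hij' heq.1.symm heq.2.symm))
    rw [Finset.card_univ, Fintype.card_prod, Fintype.card_prod, Fintype.card_fin,
      Fintype.card_fin] at h
    refine le_trans ?_ h
    refine Nat.cast_le.mpr (Finset.card_le_card fun c hc => ?_)
    simp only [hBad, Finset.mem_filter, Finset.mem_univ, true_and] at hc
    simp only [Finset.mem_filter, Finset.mem_univ, true_and, forall_const]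
    intro t
    obtain ⟨i, j, hij, hne⟩ := hc (F t) (hmono t) (hmem t)
    refine ⟨(F t i, F t j), ?_, ?_⟩
    · exact Finset.mem_image.mpr ⟨(i, j), by simpa [hP] using hij, rfl⟩
    · rw [hτ']; exact hne
  have hcover : (Finset.univ : Finset (Fin N × Fin N → Fin k × Fin k)) ⊆
      ((Finset.univ : Finset (Fin N)).powersetCard n).biUnion Bad := by
    intro c _
    obtain ⟨A, hA, h⟩ := hno c
    refine Finset.mem_biUnion.mpr ⟨A, Finset.mem_powersetCard.mpr ⟨Finset.subset_univ A, hA⟩, ?_⟩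
    simp only [hBad, Finset.mem_filter, Finset.mem_univ, true_and]
    exact h
  have h1 : Ω ≤ ∑ A ∈ (Finset.univ : Finset (Fin N)).powersetCard n, ((Bad A).card : ℝ) := by
    have := (Finset.card_le_card hcover).trans Finset.card_biUnion_le
    rw [Finset.card_univ] at this
    rw [hΩ]
    exact_mod_cast this
  have h2 : ∑ A ∈ (Finset.univ : Finset (Fin N)).powersetCard n, ((Bad A).card : ℝ) ≤
      (N : ℝ) ^ n * (Ω * δ ^ (x * x)) := by
    calc _ ≤ ∑ A ∈ (Finset.univ : Finset (Fin N)).powersetCard n, Ω * δ ^ (x * x) :=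
          Finset.sum_le_sum fun A hA => hbad A (Finset.mem_powersetCard.mp hA).2
      _ = (N.choose n : ℝ) * (Ω * δ ^ (x * x)) := by
          rw [Finset.sum_const, Finset.card_powersetCard, Finset.card_univ, Fintype.card_fin,
            nsmul_eq_mul]
      _ ≤ _ := by
          refine mul_le_mul_of_nonneg_right ?_ (by positivity)
          exact_mod_cast Nat.choose_le_pow N n
  have h3 : Ω * ((N : ℝ) ^ n * δ ^ (x * x)) < Ω * 1 := mul_lt_mul_of_pos_left hN hΩ0
  linarith

/-- The labeling of all ordered pairs given by its values at the increasing ones. -/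
def labelingOf {N k : ℕ} [NeZero k] (c : Fin N × Fin N → Fin k × Fin k) (u v : Fin N) :
    Fin k × Fin k :=
  if u < v then c (u, v) else if v < u then (c (v, u)).swap else (0, 0)

theorem isLabeling_labelingOf {N k : ℕ} [NeZero k] (c : Fin N × Fin N → Fin k × Fin k) :
    IsLabeling (labelingOf c) := by
  intro u v
  unfold labelingOf
  rcases lt_trichotomy u v with h | rfl | h
  · simp [h, h.not_gt]
  · simp
  · simp [h, h.not_gt]

theorem consistent_labelingOf {N k : ℕ} [NeZero k] {c : Fin N × Fin N → Fin k × Fin k}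
    {f : Fin k → Fin N} (hf : StrictMono f) (hc : ∀ i j, i < j → c (f i, f j) = (i, j)) :
    Consistent (labelingOf c) f := by
  intro i j hij
  unfold labelingOf
  rcases lt_or_gt_of_ne hij with h | h
  · rw [if_pos (hf h), hc i j h]
  · rw [if_neg (hf h).not_gt, if_pos (hf h), hc j i h]
    rfl

/-- The coloring in which the red edges are the images of the consistent tuples of a random
labeling. -/
theorem not_arrows {k : ℕ} (hk : 4 ≤ k) (m : ℕ) {n x N : ℕ} (hx : k * ((k + 1) * x) ≤ n)
    (hN : (N : ℝ) ^ n * (1 - (((k * k : ℕ) : ℝ) ^ (k * k))⁻¹) ^ (x * x) < 1) :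
    ¬ Arrows k (k ^ m) (g k (k ^ m) + 1) n N := by
  classical
  have : NeZero k := ⟨by omega⟩
  obtain ⟨c, hc⟩ := exists_map_hitting (by omega) hx hN
  intro h
  rcases h (fun e => decide (∃ f : Fin k → Fin N, Consistent (labelingOf c) f ∧
    Finset.univ.image f = e)) with ⟨A, hA, hblue⟩ | ⟨S, hS, hred⟩
  · obtain ⟨f, hf, hfA, hfc⟩ := hc A hA
    have h1 := hblue (Finset.univ.image f) (Finset.mem_powersetCard.mpr ⟨?_, ?_⟩)
    · simp only [decide_eq_false_iff_not] at h1
      exact h1 ⟨f, consistent_labelingOf hf hfc, rfl⟩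
    · intro v hv
      obtain ⟨i, -, rfl⟩ := Finset.mem_image.mp hv
      exact hfA i
    · rw [Finset.card_image_of_injective _ hf.injective]
      simp
  · have h1 := card_images_le_g hk (isLabeling_labelingOf c) m S hS
    simp only [decide_eq_true_eq] at hred
    have h2 := hred.trans (le_of_eq_of_le (by congr!) h1)
    omega

theorem isExponentialInPower_r {k : ℕ} (hk : 4 ≤ k) (m : ℕ) :
    IsExponentialInPower (r k (k ^ m) (g k (k ^ m) + 1)) := by
  refine ⟨1 / 2, by norm_num, ?_⟩
  set δ : ℝ := (((k * k : ℕ) : ℝ) ^ (k * k))⁻¹ with hδ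
  have hkk : (1 : ℝ) ≤ ((k * k : ℕ) : ℝ) := by
    exact_mod_cast Nat.mul_pos (by omega : 0 < k) (by omega : 0 < k)
  have hδ0 : 0 < δ := by rw [hδ]; positivity
  have hδ1 : δ ≤ 1 := inv_le_one_of_one_le₀ (one_le_pow₀ hkk)
  set a : ℕ := k * (k + 1) with ha
  have ha0 : 0 < a := by rw [ha]; positivity
  have haR : (0 : ℝ) < a := by exact_mod_cast ha0
  have hlim : Tendsto (fun n : ℕ => Real.sqrt n) atTop atTop :=
    Real.tendsto_sqrt_atTop.comp tendsto_natCast_atTop_atTop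
  filter_upwards [hlim.eventually_gt_atTop (4 * a ^ 2 / δ), eventually_ge_atTop a,
    eventually_ge_atTop 1] with n hn1 hn2 hn3
  rw [← Real.sqrt_eq_rpow]
  have key : ∀ N : ℕ, Arrows k (k ^ m) (g k (k ^ m) + 1) n N →
      (2 : ℝ) ^ Real.sqrt n ≤ N := by
    intro N hN
    by_contra! hlt
    set x := n / a with hx
    refine not_arrows hk m (x := x) ?_ ?_ hN
    · rw [← mul_assoc]
      exact Nat.mul_div_le n a
    -- `N ^ n ≤ exp (√n * n)` while the other factor is at most `exp (-δ * x ^ 2)`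
    have hs0 : 0 ≤ Real.sqrt n := Real.sqrt_nonneg _
    have hs2 : Real.sqrt n * Real.sqrt n = n := Real.mul_self_sqrt (Nat.cast_nonneg n)
    have hn0 : (0 : ℝ) < n := by exact_mod_cast hn3
    have h1 : (N : ℝ) ^ n ≤ Real.exp (Real.sqrt n * n) := by
      have h2 : (N : ℝ) ≤ Real.exp (Real.sqrt n) := by
        refine hlt.le.trans ?_
        rw [Real.rpow_def_of_pos (by norm_num)]
        refine Real.exp_le_exp.mpr ?_
        have := Real.log_two_lt_d9
        nlinarith
      calc (N : ℝ) ^ n ≤ Real.exp (Real.sqrt n) ^ n := pow_le_pow_left₀ (Nat.cast_nonneg N) h2 n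
        _ = _ := by rw [← Real.exp_nat_mul, mul_comm]
    have h2 : (1 - δ) ^ (x * x) ≤ Real.exp (-(δ * (x * x))) := by
      have h3 : 1 - δ ≤ Real.exp (-δ) := by
        have := Real.add_one_le_exp (-δ); linarith
      calc (1 - δ) ^ (x * x) ≤ Real.exp (-δ) ^ (x * x) := pow_le_pow_left₀ (by linarith) h3 _
        _ = _ := by rw [← Real.exp_nat_mul]; push_cast; ring_nf
    have hx2 : (n : ℝ) ≤ 2 * a * x := by
      have h3 : 1 ≤ x := Nat.div_pos hn2 ha0
      have h4 : n < a * (x + 1) := by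
        have := Nat.lt_mul_div_succ n ha0
        exact this
      have h5 : n ≤ 2 * a * x := by nlinarith
      exact_mod_cast h5
    have h3 : Real.sqrt n * n < δ * (x * x) := by
      rw [div_lt_iff₀ hδ0] at hn1
      have h4 : (n : ℝ) * n ≤ 4 * a ^ 2 * (x * x) := by
        have := mul_le_mul hx2 hx2 hn0.le (by positivity)
        linarith
      have h5 : 4 * (a : ℝ) ^ 2 * (Real.sqrt n * n) < 4 * a ^ 2 * (δ * (x * x)) := by
        calc 4 * (a : ℝ) ^ 2 * (Real.sqrt n * n) < (Real.sqrt n * δ) * (Real.sqrt n * n) := by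
              refine mul_lt_mul_of_pos_right hn1 ?_
              have : 0 < Real.sqrt n := Real.sqrt_pos.mpr hn0
              positivity
          _ = δ * (n * n) := by linear_combination δ * n * hs2
          _ ≤ δ * (4 * a ^ 2 * (x * x)) := mul_le_mul_of_nonneg_left h4 hδ0.le
          _ = _ := by ring
      exact lt_of_mul_lt_mul_left h5 (by positivity)
    calc (N : ℝ) ^ n * (1 - δ) ^ (x * x)
        ≤ Real.exp (Real.sqrt n * n) * Real.exp (-(δ * (x * x))) :=
          mul_le_mul h1 h2 (pow_nonneg (by linarith) _) (Real.exp_nonneg _)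
      _ = Real.exp (Real.sqrt n * n - δ * (x * x)) := by rw [← Real.exp_add]; ring_nf
      _ < 1 := by rw [Real.exp_lt_one_iff]; linarith
  have h1 : ((⌈(2 : ℝ) ^ Real.sqrt n⌉₊ : ℕ) : ℕ∞) ≤ r k (k ^ m) (g k (k ^ m) + 1) n :=
    le_iInf₂ fun N hN => Nat.cast_le.mpr (Nat.ceil_le.mpr (key N hN))
  have h2 : (((⌈(2 : ℝ) ^ Real.sqrt n⌉₊ : ℕ) : ℕ∞) : ENNReal) ≤
      ((r k (k ^ m) (g k (k ^ m) + 1) n : ℕ∞) : ENNReal) := by exact_mod_cast h1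
  refine le_trans ?_ h2
  rw [ENat.toENNReal_coe, ← ENNReal.ofReal_natCast]
  exact ENNReal.ofReal_le_ofReal (Nat.le_ceil _)

/-! ### Supersaturation and the polynomial upper bound -/

/-- Double counting of the pairs consisting of an `L`-set and a member of `𝓕` inside it. -/
theorem choose_le_card_mul_choose {α : Type*} [DecidableEq α] {D : Finset α}
    {𝓕 : Finset (Finset α)} {q L : ℕ} (h𝓕 : ∀ A ∈ 𝓕, A ⊆ D ∧ A.card = q)
    (hL : ∀ S ⊆ D, S.card = L → ∃ A ∈ 𝓕, A ⊆ S) (hLD : L ≤ D.card) :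
    D.card.choose q ≤ 𝓕.card * L.choose q := by
  have hqL : q ≤ L := by
    obtain ⟨S, hSD, hS⟩ := Finset.exists_subset_card_eq hLD
    obtain ⟨A, hA, hAS⟩ := hL S hSD hS
    rw [← hS, ← (h𝓕 A hA).2]
    exact Finset.card_le_card hAS
  have h1 : D.card.choose L ≤ 𝓕.card * (D.card - q).choose (L - q) := by
    have hsub : D.powersetCard L ⊆
        𝓕.biUnion fun A => (D.powersetCard L).filter fun S => A ⊆ S := by
      intro S hS
      obtain ⟨hSD, hSc⟩ := Finset.mem_powersetCard.mp hS
      obtain ⟨A, hA, hAS⟩ := hL S hSD hSc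
      exact Finset.mem_biUnion.mpr ⟨A, hA, Finset.mem_filter.mpr ⟨hS, hAS⟩⟩
    have h2 := Finset.card_le_card hsub
    rw [Finset.card_powersetCard] at h2
    refine h2.trans (Finset.card_biUnion_le_card_mul _ _ _ fun A hA => ?_)
    obtain ⟨hAD, hAc⟩ := h𝓕 A hA
    have h3 : ((D.powersetCard L).filter fun S => A ⊆ S).card ≤
        ((D \ A).powersetCard (L - q)).card := by
      refine Finset.card_le_card_of_injOn (fun S => S \ A) ?_ ?_
      · intro S hS
        simp only [Finset.coe_filter, Finset.mem_powersetCard, Set.mem_ofPred_eq] at hS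
        simp only [Finset.mem_coe, Finset.mem_powersetCard]
        refine ⟨Finset.sdiff_subset_sdiff hS.1.1 le_rfl, ?_⟩
        rw [Finset.card_sdiff_of_subset hS.2, hS.1.2, hAc]
      · intro S hS S' hS' h
        simp only [Finset.coe_filter, Finset.mem_powersetCard, Set.mem_ofPred_eq] at hS hS' h
        rw [← Finset.sdiff_union_of_subset hS.2, ← Finset.sdiff_union_of_subset hS'.2, h]
    rwa [Finset.card_powersetCard, Finset.card_sdiff_of_subset hAD, hAc] at h3
  have h2 := Nat.choose_mul (n := D.card) hqL
  have h3 : 0 < (D.card - q).choose (L - q) := Nat.choose_pos (by omega)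
  refine Nat.le_of_mul_le_mul_right ?_ h3
  rw [← h2]
  calc D.card.choose L * L.choose q
      ≤ (𝓕.card * (D.card - q).choose (L - q)) * L.choose q := Nat.mul_le_mul_right _ h1
    _ = _ := by ring

/-- Supersaturation: a family with a member in every `L`-set contains a constant proportion of all
`q`-sets, the constant being a power of `L`. -/
theorem card_pow_le {α : Type*} [DecidableEq α] {D : Finset α} {𝓕 : Finset (Finset α)} {q L : ℕ}
    (h𝓕 : ∀ A ∈ 𝓕, A ⊆ D ∧ A.card = q) (hL : ∀ S ⊆ D, S.card = L → ∃ A ∈ 𝓕, A ⊆ S)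
    (hLD : L ≤ D.card) (hq : 2 * q ≤ D.card) :
    D.card ^ q ≤ 𝓕.card * ((2 * L) ^ q * q.factorial) := by
  have h1 := choose_le_card_mul_choose h𝓕 hL hLD
  have h2 : (D.card + 1 - q) ^ q ≤ q.factorial * D.card.choose q := by
    have h := Nat.pow_le_choose (α := ℚ) q D.card
    rw [div_le_iff₀ (by positivity)] at h
    rw [mul_comm]
    exact_mod_cast h
  have h3 : L.choose q ≤ L ^ q := Nat.choose_le_pow L q
  calc D.card ^ q ≤ (2 * (D.card + 1 - q)) ^ q := Nat.pow_le_pow_left (by omega) q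
    _ = 2 ^ q * (D.card + 1 - q) ^ q := mul_pow _ _ _
    _ ≤ 2 ^ q * (q.factorial * D.card.choose q) := Nat.mul_le_mul_left _ h2
    _ ≤ 2 ^ q * (q.factorial * (𝓕.card * L ^ q)) := by gcongr; exact h1.trans (by gcongr)
    _ = _ := by rw [mul_pow]; ring

theorem le_pow_self_of_two_le {n : ℕ} (hn : 2 ≤ n) (a : ℕ) : a ≤ n ^ a :=
  (Nat.lt_pow_self (by omega)).le

/-- If every set of `n ^ a` vertices contains a member of `𝓕` and `R` is a relation of density at
least `n ^ (-c)`, then `R` contains a product of members of `𝓕`. The coordinates are treated one by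
one: by supersaturation, some member of `𝓕` is contained in many of the fibers of `R` over the other
coordinates. -/
theorem exists_product_subset (q a j : ℕ) : ∀ c : ℕ, ∃ C : ℕ, ∀ n : ℕ, 2 ≤ n →
    ∀ (α : Type) [DecidableEq α] (D : Finset α) (𝓕 : Finset α → Prop),
    (∀ A, 𝓕 A → A.card = q) → (∀ S ⊆ D, n ^ a ≤ S.card → ∃ A ⊆ S, 𝓕 A) → n ^ C ≤ D.card →
    ∀ R : Finset (Fin j → α), R ⊆ Fintype.piFinset (fun _ => D) → D.card ^ j ≤ n ^ c * R.card →
    ∃ A : Fin j → Finset α, (∀ i, 𝓕 (A i) ∧ A i ⊆ D) ∧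
      ∀ f : Fin j → α, (∀ i, f i ∈ A i) → f ∈ R := by
  classical
  induction j with
  | zero =>
    intro c
    refine ⟨0, fun n hn α _ D 𝓕 _ _ _ R _ hR => ⟨Fin.elim0, fun i => i.elim0, fun f _ => ?_⟩⟩
    have h1 : R.Nonempty := by
      rw [← Finset.card_pos]
      by_contra! h
      simp [Nat.le_zero.mp h] at hR
    obtain ⟨f', hf'⟩ := h1
    rwa [Subsingleton.elim f f']
  | succ j ih =>
    intro c
    obtain ⟨C, hC⟩ := ih (1 + c + (2 + c + a) * q + q.factorial)
    refine ⟨C + (1 + c + a + 2 * q), fun n hn α _ D 𝓕 hq hD hCD R hRD hR => ?_⟩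
    set N := D.card with hN
    have hn0 : 0 < n := by omega
    have hN0 : 0 < N := lt_of_lt_of_le (pow_pos hn0 _) hCD
    set G : Finset (Fin j → α) := Fintype.piFinset fun _ => D with hG
    have hGc : G.card = N ^ j := by simp [hG, hN]
    set fib : (Fin j → α) → Finset α := fun g => D.filter fun v => Fin.cons v g ∈ R with hfib
    have hfibD : ∀ g, fib g ⊆ D := fun g => Finset.filter_subset _ _
    have hRsum : R.card ≤ ∑ g ∈ G, (fib g).card := by
      rw [Finset.card_eq_sum_card_fiberwise (f := Fin.tail) (t := G)]
      · refine Finset.sum_le_sum fun g _ => ?_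
        refine Finset.card_le_card_of_injOn (fun f => f 0) ?_ ?_
        · intro f hf
          simp only [Finset.coe_filter, Set.mem_ofPred_eq] at hf
          simp only [hfib, Finset.coe_filter, Set.mem_ofPred_eq]
          refine ⟨Fintype.mem_piFinset.mp (hRD hf.1) 0, ?_⟩
          rw [← hf.2, Fin.cons_self_tail]
          exact hf.1
        · intro f hf f' hf' h
          simp only [Finset.coe_filter, Set.mem_ofPred_eq] at hf hf' h
          rw [← Fin.cons_self_tail f, ← Fin.cons_self_tail f', hf.2, hf'.2, h]
      · intro f hf
        rw [Finset.mem_coe, hG, Fintype.mem_piFinset]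
        intro i
        exact Fintype.mem_piFinset.mp (hRD hf) i.succ
    -- the fibers that are not much smaller than the average
    set G' : Finset (Fin j → α) := G.filter fun g => N ≤ 2 * n ^ c * (fib g).card with hG'
    have hG'c : N ^ j ≤ 2 * n ^ c * G'.card := by
      have h1 : ∑ g ∈ G, 2 * n ^ c * (fib g).card ≤ 2 * n ^ c * (G'.card * N) + N ^ j * N := by
        rw [← Finset.sum_filter_add_sum_filter_not G fun g => N ≤ 2 * n ^ c * (fib g).card]
        refine Nat.add_le_add ?_ ?_
        · rw [← Finset.mul_sum]
          refine Nat.mul_le_mul_left _ ?_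
          rw [← smul_eq_mul]
          exact Finset.sum_le_card_nsmul _ _ _ fun g _ => Finset.card_le_card (hfibD g)
        · rw [← hGc]
          refine le_trans (Finset.sum_le_card_nsmul _ _ N fun g hg => ?_) ?_
          · exact (not_le.mp (Finset.mem_filter.mp hg).2).le
          · rw [smul_eq_mul]
            exact Nat.mul_le_mul_right _ (Finset.card_filter_le _ _)
      have h2 : 2 * (N ^ j * N) ≤ ∑ g ∈ G, 2 * n ^ c * (fib g).card := by
        rw [← Finset.mul_sum, mul_assoc]
        refine Nat.mul_le_mul_left _ ?_
        rw [← pow_succ]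
        exact hR.trans (Nat.mul_le_mul_left _ hRsum)
      refine Nat.le_of_mul_le_mul_right ?_ hN0
      have h3 : 2 * n ^ c * G'.card * N = 2 * n ^ c * (G'.card * N) := by ring
      omega
    have hexp : ∀ e, e ≤ C + (1 + c + a + 2 * q) → n ^ e ≤ N := fun e he =>
      (Nat.pow_le_pow_right hn0 he).trans hCD
    have hlarge : ∀ g ∈ G', ∀ b, b ≤ n ^ (a + 2 * q) → b ≤ (fib g).card := by
      intro g hg b hb
      have h1 := (Finset.mem_filter.mp hg).2
      have h2 : 2 * n ^ c * b ≤ N := by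
        calc 2 * n ^ c * b ≤ n * n ^ c * n ^ (a + 2 * q) := by gcongr
          _ = n ^ (1 + c + a + 2 * q) := by ring
          _ ≤ N := hexp _ (by omega)
      exact Nat.le_of_mul_le_mul_left (h2.trans h1) (by positivity)
    set 𝒜 : Finset (Finset α) := (D.powersetCard q).filter 𝓕 with h𝒜
    set K := (4 * n ^ (c + a)) ^ q * q.factorial with hK
    have hsuper : ∀ g ∈ G', N ^ q ≤ K * (𝒜.filter fun A => A ⊆ fib g).card := by
      intro g hg
      have h1 := card_pow_le (D := fib g) (𝓕 := 𝒜.filter fun A => A ⊆ fib g) (q := q)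
        (L := n ^ a) (fun A hA => by
          simp only [h𝒜, Finset.mem_filter, Finset.mem_powersetCard] at hA
          exact ⟨hA.2, hA.1.1.2⟩) (fun S hS hSc => by
          obtain ⟨A, hAS, hA⟩ := hD S (hS.trans (hfibD g)) hSc.ge
          refine ⟨A, ?_, hAS⟩
          simp only [h𝒜, Finset.mem_filter, Finset.mem_powersetCard]
          exact ⟨⟨⟨hAS.trans (hS.trans (hfibD g)), hq A hA⟩, hA⟩, hAS.trans hS⟩)
        (hlarge g hg _ (Nat.pow_le_pow_right hn0 (by omega)))
        (hlarge g hg _ ((le_pow_self_of_two_le hn _).trans (Nat.pow_le_pow_right hn0 (by omega))))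
      have h2 := (Finset.mem_filter.mp hg).2
      calc N ^ q ≤ (2 * n ^ c * (fib g).card) ^ q := Nat.pow_le_pow_left h2 q
        _ = (2 * n ^ c) ^ q * (fib g).card ^ q := mul_pow _ _ _
        _ ≤ (2 * n ^ c) ^ q * ((𝒜.filter fun A => A ⊆ fib g).card *
            ((2 * n ^ a) ^ q * q.factorial)) := Nat.mul_le_mul_left _ h1
        _ = (2 * n ^ c * (2 * n ^ a)) ^ q * q.factorial *
            (𝒜.filter fun A => A ⊆ fib g).card := by rw [mul_pow (2 * n ^ c)]; ring
        _ = K * (𝒜.filter fun A => A ⊆ fib g).card := by rw [hK]; congr 3; ring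
    have hdouble : N ^ q * N ^ j ≤
        ∑ A ∈ 𝒜, 2 * n ^ c * K * (G'.filter fun g => A ⊆ fib g).card := by
      calc N ^ q * N ^ j ≤ N ^ q * (2 * n ^ c * G'.card) := Nat.mul_le_mul_left _ hG'c
        _ = 2 * n ^ c * ∑ _g ∈ G', N ^ q := by rw [Finset.sum_const, smul_eq_mul]; ring
        _ ≤ 2 * n ^ c * ∑ g ∈ G', K * (𝒜.filter fun A => A ⊆ fib g).card :=
            Nat.mul_le_mul_left _ (Finset.sum_le_sum hsuper)
        _ = 2 * n ^ c * K * ∑ g ∈ G', (𝒜.filter fun A => A ⊆ fib g).card := by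
            rw [← Finset.mul_sum]; ring
        _ = 2 * n ^ c * K * ∑ A ∈ 𝒜, (G'.filter fun g => A ⊆ fib g).card := by
            congr 1
            simp only [Finset.card_filter]
            exact Finset.sum_comm
        _ = _ := by rw [Finset.mul_sum]
    have h𝒜c : 𝒜.card ≤ N ^ q := by
      refine (Finset.card_filter_le _ _).trans ?_
      rw [Finset.card_powersetCard]
      exact Nat.choose_le_pow _ _
    have h𝒜ne : 𝒜.Nonempty := by
      by_contra! h
      rw [h, Finset.sum_empty] at hdouble
      have : 0 < N ^ q * N ^ j := by positivity
      omega
    obtain ⟨A, hA, hAle⟩ := Finset.exists_le_of_sum_le (f := fun _ => N ^ j)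
      (g := fun A => 2 * n ^ c * K * (G'.filter fun g => A ⊆ fib g).card) h𝒜ne (by
      rw [Finset.sum_const, smul_eq_mul]
      exact (Nat.mul_le_mul_right _ h𝒜c).trans hdouble)
    simp only [h𝒜, Finset.mem_filter, Finset.mem_powersetCard] at hA
    have hX : 2 * n ^ c * K ≤ n ^ (1 + c + (2 + c + a) * q + q.factorial) := by
      have h1 : q.factorial ≤ n ^ q.factorial := le_pow_self_of_two_le hn _
      have h2 : 4 ≤ n ^ 2 := by nlinarith
      calc 2 * n ^ c * K ≤ n * n ^ c * ((n ^ 2 * n ^ (c + a)) ^ q * n ^ q.factorial) := by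
            rw [hK]; gcongr
        _ = _ := by
            rw [← pow_succ', ← pow_add n 2, ← pow_mul, ← pow_add, ← pow_add]
            congr 1; ring
    obtain ⟨A', hA', hprod⟩ := hC n hn α D 𝓕 hq hD (hexp C (by omega))
      (G.filter fun g => A ⊆ fib g) (Finset.filter_subset _ _) (by
        refine hAle.trans (Nat.mul_le_mul hX (Finset.card_le_card ?_))
        exact Finset.filter_subset_filter _ (Finset.filter_subset _ _))
    refine ⟨Fin.cons A A', fun i => ?_, fun f hf => ?_⟩
    · refine Fin.cases ?_ (fun i => ?_) i
      · simpa using ⟨hA.2, hA.1.1⟩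
      · simpa using hA' i
    · have h1 := hprod (Fin.tail f) fun i => by simpa [Fin.tail] using hf i.succ
      have h2 := (Finset.mem_filter.mp h1).2 (by simpa using hf 0)
      have h3 := (Finset.mem_filter.mp h2).2
      rwa [Fin.cons_self_tail] at h3

/-- The number of red edges in the union of `k` sets all of whose transversals are red. -/
theorem le_card_red_biUnion {α : Type*} [DecidableEq α] {k q t : ℕ} (hk : 2 ≤ k) (hq : 1 ≤ q)
    (red : Finset α → Bool) (A : Fin k → Finset α) (hA : ∀ i, (A i).card = q)
    (ht : ∀ i, t ≤ (((A i).powersetCard k).filter fun e => red e = true).card)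
    (htrans : ∀ f : Fin k → α, (∀ i, f i ∈ A i) →
      Function.Injective f ∧ red (Finset.univ.image f) = true) :
    (Finset.univ.biUnion A).card = k * q ∧ k * t + q ^ k ≤
      (((Finset.univ.biUnion A).powersetCard k).filter fun e => red e = true).card := by
  have hne : ∀ i, (A i).Nonempty := fun i => by rw [← Finset.card_pos, hA]; omega
  choose p hp using fun i => (hne i)
  have hdisj : ∀ i j, i ≠ j → Disjoint (A i) (A j) := by
    intro i j hij
    rw [Finset.disjoint_left]
    intro v hi hj
    have h1 := (htrans (fun n => if n = i ∨ n = j then v else p n) (fun n => by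
      by_cases h : n = i ∨ n = j
      · rw [if_pos h]
        rcases h with rfl | rfl
        exacts [hi, hj]
      · rw [if_neg h]
        exact hp n)).1
    exact hij (h1 (by simp))
  refine ⟨?_, ?_⟩
  · rw [Finset.card_biUnion fun i _ j _ hij => hdisj i j hij]
    simp [hA]
  set E : Fin k → Finset (Finset α) := fun i =>
    ((A i).powersetCard k).filter fun e => red e = true with hE
  set T : Finset (Finset α) := (Fintype.piFinset A).image fun f => Finset.univ.image f with hT
  have hTcard : T.card = q ^ k := by
    rw [hT, Finset.card_image_of_injOn]
    · simp [hA]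
    · intro f hf f' hf' h
      rw [Finset.mem_coe, Fintype.mem_piFinset] at hf hf'
      funext i
      have h1 : f i ∈ Finset.univ.image f' := by
        have h2 : Finset.univ.image f = Finset.univ.image f' := h
        rw [← h2]
        exact Finset.mem_image_of_mem f (Finset.mem_univ i)
      obtain ⟨j, -, hj⟩ := Finset.mem_image.mp h1
      by_cases hij : i = j
      · rw [hij, hj, hij]
      · exact absurd (hf i) (Finset.disjoint_right.mp (hdisj i j hij) (hj ▸ hf' j))
  have hEdisj : ∀ i j, i ≠ j → Disjoint (E i) (E j) := by
    intro i j hij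
    rw [Finset.disjoint_left]
    intro e hi hj
    simp only [hE, Finset.mem_filter, Finset.mem_powersetCard] at hi hj
    obtain ⟨v, hv⟩ : e.Nonempty := by rw [← Finset.card_pos, hi.1.2]; omega
    exact Finset.disjoint_left.mp (hdisj i j hij) (hi.1.1 hv) (hj.1.1 hv)
  have hET : Disjoint (Finset.univ.biUnion E) T := by
    rw [Finset.disjoint_left]
    intro e he heT
    obtain ⟨i, -, hi⟩ := Finset.mem_biUnion.mp he
    obtain ⟨f, hf, rfl⟩ := Finset.mem_image.mp heT
    rw [Fintype.mem_piFinset] at hf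
    simp only [hE, Finset.mem_filter, Finset.mem_powersetCard] at hi
    have : Nontrivial (Fin k) := Fin.nontrivial_iff_two_le.mpr hk
    obtain ⟨j, hj⟩ := exists_ne i
    exact Finset.disjoint_left.mp (hdisj i j hj.symm)
      (hi.1.1 (Finset.mem_image_of_mem f (Finset.mem_univ j))) (hf j)
  have hsub : Finset.univ.biUnion E ∪ T ⊆
      ((Finset.univ.biUnion A).powersetCard k).filter fun e => red e = true := by
    intro e he
    rw [Finset.mem_filter, Finset.mem_powersetCard]
    rcases Finset.mem_union.mp he with he | he
    · obtain ⟨i, -, hi⟩ := Finset.mem_biUnion.mp he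
      simp only [hE, Finset.mem_filter, Finset.mem_powersetCard] at hi
      exact ⟨⟨hi.1.1.trans (Finset.subset_biUnion_of_mem A (Finset.mem_univ i)), hi.1.2⟩, hi.2⟩
    · obtain ⟨f, hf, rfl⟩ := Finset.mem_image.mp he
      rw [Fintype.mem_piFinset] at hf
      obtain ⟨hinj, hred⟩ := htrans f hf
      refine ⟨⟨fun v hv => ?_, ?_⟩, hred⟩
      · obtain ⟨i, -, rfl⟩ := Finset.mem_image.mp hv
        exact Finset.mem_biUnion.mpr ⟨i, Finset.mem_univ i, hf i⟩
      · rw [Finset.card_image_of_injective _ hinj]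
        simp
  refine le_trans ?_ (Finset.card_le_card hsub)
  rw [Finset.card_union_of_disjoint hET, hTcard,
    Finset.card_biUnion fun i _ j _ hij => hEdisj i j hij]
  refine Nat.add_le_add_right ?_ _
  have h := Finset.card_nsmul_le_sum Finset.univ (fun i => (E i).card) t fun i _ => ht i
  simpa using h

/-- Without a blue set of size `n`, polynomially many vertices contain an iterated balanced complete
`k`-partite red hypergraph. -/
theorem exists_card_pow_red {k : ℕ} (hk : 2 ≤ k) (m : ℕ) : ∃ C : ℕ, ∀ n : ℕ, 2 ≤ n →
    ∀ (N : ℕ) (red : Finset (Fin N) → Bool),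
    (∀ A : Finset (Fin N), A.card = n → ∃ e ∈ A.powersetCard k, red e = true) →
    ∀ D : Finset (Fin N), n ^ C ≤ D.card → ∃ A ⊆ D, A.card = k ^ m ∧
      g k (k ^ m) ≤ ((A.powersetCard k).filter fun e => red e = true).card := by
  classical
  induction m with
  | zero =>
    refine ⟨0, fun n hn N red _ D hD => ?_⟩
    rw [pow_zero] at hD
    obtain ⟨A, hA, hAc⟩ := Finset.exists_subset_card_eq hD
    refine ⟨A, hA, hAc, ?_⟩
    rw [pow_zero, g, if_pos (by omega)]
    exact Nat.zero_le _
  | succ m ih =>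
    obtain ⟨a, ha⟩ := ih
    obtain ⟨C, hC⟩ := exists_product_subset (k ^ m) a k (2 * k + k.factorial)
    refine ⟨C + (1 + 2 * k), fun n hn N red hred D hD => ?_⟩
    have hexp : ∀ e, e ≤ C + (1 + 2 * k) → n ^ e ≤ D.card := fun e he =>
      (Nat.pow_le_pow_right (by omega) he).trans hD
    set 𝓡 : Finset (Finset (Fin N)) := (D.powersetCard k).filter fun e => red e = true with h𝓡
    set R : Finset (Fin k → Fin N) := (Fintype.piFinset fun _ => D).filter fun f =>
      Function.Injective f ∧ red (Finset.univ.image f) = true with hR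
    have h1 : D.card ^ k ≤ 𝓡.card * ((2 * n) ^ k * k.factorial) := by
      refine card_pow_le (fun A hA => ?_) (fun S hS hSc => ?_) ?_ ?_
      · exact Finset.mem_powersetCard.mp (Finset.mem_filter.mp hA).1
      · obtain ⟨e, he, hered⟩ := hred S hSc
        rw [Finset.mem_powersetCard] at he
        exact ⟨e, Finset.mem_filter.mpr
          ⟨Finset.mem_powersetCard.mpr ⟨he.1.trans hS, he.2⟩, hered⟩, he.1⟩
      · simpa using hexp 1 (by omega)
      · exact (le_pow_self_of_two_le hn _).trans (hexp _ (by omega))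
    have h2 : 𝓡.card ≤ R.card := by
      have hsub : 𝓡 ⊆ R.image fun f => Finset.univ.image f := by
        intro e he
        simp only [h𝓡, Finset.mem_filter, Finset.mem_powersetCard] at he
        have himg : Finset.univ.image (e.orderEmbOfFin he.1.2) = e := by
          rw [← Finset.coe_inj, Finset.coe_image, Finset.coe_univ, Set.image_univ,
            Finset.range_orderEmbOfFin]
        refine Finset.mem_image.mpr ⟨e.orderEmbOfFin he.1.2, ?_, himg⟩
        rw [hR, Finset.mem_filter, Fintype.mem_piFinset]
        refine ⟨fun i => he.1.1 (e.orderEmbOfFin_mem _ i),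
          (e.orderEmbOfFin he.1.2).injective, ?_⟩
        rw [himg]
        exact he.2
      exact (Finset.card_le_card hsub).trans Finset.card_image_le
    have h3 : D.card ^ k ≤ n ^ (2 * k + k.factorial) * R.card := by
      have h4 : k.factorial ≤ n ^ k.factorial := le_pow_self_of_two_le hn _
      calc D.card ^ k ≤ 𝓡.card * ((2 * n) ^ k * k.factorial) := h1
        _ ≤ R.card * ((n * n) ^ k * n ^ k.factorial) := by gcongr
        _ = _ := by rw [← pow_two, ← pow_mul, ← pow_add, mul_comm]
    obtain ⟨A, hA, hprod⟩ := hC n hn (Fin N) D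
      (fun A => A.card = k ^ m ∧
        g k (k ^ m) ≤ ((A.powersetCard k).filter fun e => red e = true).card)
      (fun A hA => hA.1) (fun S _ hS => ha n hn N red hred S hS) (hexp C (by omega)) R
      (Finset.filter_subset _ _) h3
    have h4 := le_card_red_biUnion hk (Nat.one_le_pow m k (by omega)) red A (fun i => (hA i).1.1)
      (fun i => (hA i).1.2) fun f hf => (Finset.mem_filter.mp (hprod f hf)).2
    refine ⟨Finset.univ.biUnion A, ?_, ?_, ?_⟩
    · exact Finset.biUnion_subset.mpr fun i _ => (hA i).2
    · rw [h4.1, pow_succ, mul_comm]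
    · rw [g_pow_succ hk]
      exact h4.2

theorem isPolynomial_r {k : ℕ} (hk : 2 ≤ k) (m : ℕ) :
    IsPolynomial (r k (k ^ m) (g k (k ^ m))) := by
  obtain ⟨C, hC⟩ := exists_card_pow_red hk m
  refine ⟨C, ?_⟩
  filter_upwards [eventually_ge_atTop 2] with n hn
  refine iInf₂_le (n ^ C) fun red => ?_
  by_cases h : ∃ A : Finset (Fin (n ^ C)), A.card = n ∧ ∀ e ∈ A.powersetCard k, red e = false
  · exact Or.inl h
  · right
    push Not at h
    obtain ⟨A, -, hA, hg⟩ := hC n hn (n ^ C) red (fun A hA => by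
      obtain ⟨e, he, hred⟩ := h A hA
      exact ⟨e, he, by simpa using hred⟩) Finset.univ (by simp)
    exact ⟨A, hA, hg⟩

theorem r_mono {k s t t' : ℕ} (h : t ≤ t') (n : ℕ) : r k s t n ≤ r k s t' n := by
  refine le_iInf₂ fun N hN => iInf₂_le N fun red => ?_
  rcases hN red with h1 | ⟨S, hS, hle⟩
  · exact Or.inl h1
  · exact Or.inr ⟨S, hS, h.trans hle⟩

/-- A function that is at least `2 ^ (n ^ c)` is not bounded by a power of `n`. -/
theorem not_isPolynomial_of_isExponentialInPower {f : ℕ → ℕ∞} (hf : IsExponentialInPower f) :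
    ¬ IsPolynomial f := by
  rintro ⟨C, hC⟩
  obtain ⟨c, hc, hexp⟩ := hf
  -- with `y = n ^ c`, compare `2 ^ y` and `y ^ (C / c)`
  have hlim : Tendsto (fun n : ℕ => ((n : ℝ) ^ c)) atTop atTop :=
    (tendsto_rpow_atTop hc).comp tendsto_natCast_atTop_atTop
  have hlog : (0 : ℝ) < Real.log 2 := Real.log_pos (by norm_num)
  have hsmall := (isLittleO_rpow_exp_pos_mul_atTop (C / c) hlog).comp_tendsto hlim
  have hev := hsmall.bound (show (0 : ℝ) < 1 / 2 by norm_num)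
  obtain ⟨n, h1, h2, h3, h4⟩ := (hC.and (hexp.and (hev.and (eventually_ge_atTop 1)))).exists
  have hn : (0 : ℝ) < n := by exact_mod_cast h4
  have h5 : ((f n : ℕ∞) : ENNReal) ≤ (((n ^ C : ℕ) : ℕ∞) : ENNReal) := by exact_mod_cast h1
  have h6 := h2.trans h5
  rw [ENat.toENNReal_coe, ← ENNReal.ofReal_natCast,
    ENNReal.ofReal_le_ofReal_iff (Nat.cast_nonneg _)] at h6
  simp only [Function.comp_apply] at h3
  rw [← Real.rpow_mul hn.le, mul_div_cancel₀ _ hc.ne', Real.rpow_natCast,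
    ← Real.rpow_def_of_pos (by norm_num : (0 : ℝ) < 2), Real.norm_of_nonneg (by positivity),
    Real.norm_of_nonneg (by positivity)] at h3
  have h7 : (0 : ℝ) < (2 : ℝ) ^ ((n : ℝ) ^ c) := by positivity
  push_cast at h6
  linarith

end ErdosHajnal

theorem corollary5 (k : ℕ) (hk : 4 ≤ k) (s : ℕ) (hs : ∃ m : ℕ, 1 ≤ m ∧ s = k ^ m) :
    ∀ h : ℕ, ErdosHajnal.IsH1 k s h ↔ h = ErdosHajnal.g k s + 1 := by
  obtain ⟨m, -, rfl⟩ := hs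
  intro h
  have hpoly := ErdosHajnal.isPolynomial_r (k := k) (by omega) m
  have hexp := ErdosHajnal.isExponentialInPower_r hk m
  constructor
  · rintro ⟨h1, hp, he⟩
    by_contra hne
    rcases Nat.lt_or_gt_of_ne hne with hlt | hgt
    · refine ErdosHajnal.not_isPolynomial_of_isExponentialInPower he ?_
      obtain ⟨C, hC⟩ := hpoly
      exact ⟨C, hC.mono fun n hn => (ErdosHajnal.r_mono (by omega) n).trans hn⟩
    · refine ErdosHajnal.not_isPolynomial_of_isExponentialInPower hexp ?_
      obtain ⟨C, hC⟩ := hp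
      exact ⟨C, hC.mono fun n hn => (ErdosHajnal.r_mono (by omega) n).trans hn⟩
  · rintro rfl
    exact ⟨by omega, hpoly, hexp⟩
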